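/- Let $T\ge 5$. For a word $\mathbf w=s_1\cdots s_T$ over the three states $\{1,2,3\}$ without self-loops ($s_t\ne s_{t+1}$ for all $t$) let $\mathbf a_{\mathbf w}\in\mathbb R^6$ be the vector of transition counts $(x_{12},x_{13},x_{21},x_{23},x_{31},x_{32})$, where $x_{ij}=\#\{t\in\{1,\dots,T-1\} : s_t=i,\ s_{t+1}=j\}$. The vectors $\mathbf a_{\mathbf w}$ are the columns of the design matrix $A^T$ of the three-state toric homogeneous Markov chain model without loops and without initial parameters; let $P^T=\operatorname{conv}(A^T)$ be their convex hull, the design polytope. A face of $P^T$ is the set of maximizers over $P^T$ of some linear form $\mathbf x\mapsto\mathbf c\cdot\mathbf x$, and a facet is a face of dimension $\dim P^T-1$. Consider the following vectors $\mathbf c=[c_{12},c_{13},c_{21},c_{23},c_{31},c_{32}]$, each for the indicated values of $T$ only (with $k$ an integer): - all $T$: $[1,0,0,0,0,0]$; - all $T$: $[T,\,T,\,-(T-2),\,1,\,-(T-2),\,1]$; - $T$ odd: $[1,1,-1,-1,1,1]$; - $T$ even: $[\tfrac32T-1,\ \tfrac T2,\ -\tfrac T2+1,\ -\tfrac T2+1,\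 -\tfrac T2+1,\ \tfrac T2]$; - $T=3k+1$: $[2,-1,-1,-1,2,2]$; - $T=3k+2$: $[2k+1,-k,-k,-k,2k+1,2k+1]$; - $T=6k+3$: $[5k+2,\ 2k+1,\ -4k-1,\ -k,\ -k,\ 2k+1]$; - $T=6k$: $[10k-1,\ 4k,\ -8k+2,\ -2k+1,\ -2k+1,\ 4k]$. Let $\mathcal C_T$ be the set of all vectors that arise from the vectors listed for $T$ by permuting the labels of the states, $c_{ij}\mapsto c_{\sigma(i)\sigma(j)}$ with $\sigma\in\mathfrak S_3$, and by reversing time, $c_{ij}\mapsto c_{ji}$. **Theorem.** For every $T\ge5$ and every $\mathbf c\in\mathcal C_T$ the inequality $\mathbf c\cdot\mathbf x\ge0$ holds on $P^T$, and $\mathbf c\mapsto\{\mathbf x\in P^T : \mathbf c\cdot\mathbf x=0\}$ is a bijection from $\mathcal C_T$ onto the set of all facets of $P^T$. There are exactly $24$ of them. -/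

import Mathlib

namespace THMC

/-- The transitions `i → j` between distinct states. The states `1, 2, 3` are the elements
`0, 1, 2` of `Fin 3`. -/
abbrev Transition : Type := {p : Fin 3 × Fin 3 // p.1 ≠ p.2}

/-- The words of length `T` on three states without self-loops. -/
abbrev Word (T : ℕ) : Type :=
  {w : Fin T → Fin 3 // ∀ (i : Fin T) (h : (i : ℕ) + 1 < T), w i ≠ w ⟨(i : ℕ) + 1, h⟩}

/-- The number of positions at which the word `w` makes the transition `p`. -/
def transitionCount {T : ℕ} (w : Word T) (p : Transition) : ℕ :=
  (Finset.univ.filter fun i : Fin T =>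
    ∃ h : (i : ℕ) + 1 < T, w.1 i = p.1.1 ∧ w.1 ⟨(i : ℕ) + 1, h⟩ = p.1.2).card

/-- The design matrix: rows indexed by transitions, columns indexed by words. -/
def designMatrix (T : ℕ) : Matrix Transition (Word T) ℝ :=
  Matrix.of fun p w => (transitionCount w p : ℝ)

/-- The design polytope, the convex hull of the columns of the design matrix. -/
def designPolytope (T : ℕ) : Set (Transition → ℝ) :=
  convexHull ℝ (Set.range fun w : Word T => (designMatrix T).col w)

/-- The dimension of (the affine hull of) a nonempty subset of `ℝ⁶`. -/
noncomputable def dim (S : Set (Transition → ℝ)) : ℕ :=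
  Module.finrank ℝ (vectorSpan ℝ S)

/-- `F` is a face of `P`: the set of maximizers over `P` of some linear functional. -/
def IsFace (P F : Set (Transition → ℝ)) : Prop :=
  ∃ c : Transition → ℝ, F = {x | x ∈ P ∧ ∀ y ∈ P, c ⬝ᵥ y ≤ c ⬝ᵥ x}

/-- `F` is a facet of `P`: a face of dimension `dim P - 1`. -/
def IsFacet (P F : Set (Transition → ℝ)) : Prop :=
  IsFace P F ∧ dim F + 1 = dim P

/-- The vector `[c₁₂, c₁₃, c₂₁, c₂₃, c₃₁, c₃₂]`. -/
def vec (c12 c13 c21 c23 c31 c32 : ℝ) : Transition → ℝ := fun p =>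
  !![0, c12, c13;
     c21, 0, c23;
     c31, c32, 0] p.1.1 p.1.2

/-- Relabelling of the states: `(relabel σ c)_{ij} = c_{σ(i)σ(j)}`. -/
def relabel (σ : Equiv.Perm (Fin 3)) (c : Transition → ℝ) : Transition → ℝ := fun p =>
  c ⟨(σ p.1.1, σ p.1.2), fun h => p.2 (σ.injective h)⟩

/-- Reversal of the direction of time: `(reverse c)_{ij} = c_{ji}`. -/
def reverse (c : Transition → ℝ) : Transition → ℝ := fun p =>
  c ⟨(p.1.2, p.1.1), p.2.symm⟩

/-- The table of representatives of the facet-defining vectors; the rows that are present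
depend on `T` modulo `6`. -/
def tableVectors (T : ℕ) : Set (Transition → ℝ) :=
  {c | c = vec 1 0 0 0 0 0
    ∨ c = vec T T (-((T : ℝ) - 2)) 1 (-((T : ℝ) - 2)) 1
    ∨ (Odd T ∧ c = vec 1 1 (-1) (-1) 1 1)
    ∨ (Even T ∧ c = vec (3 / 2 * (T : ℝ) - 1) ((T : ℝ) / 2) (-(T : ℝ) / 2 + 1)
        (-(T : ℝ) / 2 + 1) (-(T : ℝ) / 2 + 1) ((T : ℝ) / 2))
    ∨ (∃ k : ℕ, T = 3 * k + 1 ∧ c = vec 2 (-1) (-1) (-1) 2 2)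
    ∨ (∃ k : ℕ, T = 3 * k + 2 ∧
        c = vec (2 * (k : ℝ) + 1) (-(k : ℝ)) (-(k : ℝ)) (-(k : ℝ)) (2 * (k : ℝ) + 1)
          (2 * (k : ℝ) + 1))
    ∨ (∃ k : ℕ, T = 6 * k + 3 ∧
        c = vec (5 * (k : ℝ) + 2) (2 * (k : ℝ) + 1) (-4 * (k : ℝ) - 1) (-(k : ℝ)) (-(k : ℝ))
          (2 * (k : ℝ) + 1))
    ∨ (∃ k : ℕ, T = 6 * k ∧
        c = vec (10 * (k : ℝ) - 1) (4 * (k : ℝ)) (-8 * (k : ℝ) + 2) (-2 * (k : ℝ) + 1)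
          (-2 * (k : ℝ) + 1) (4 * (k : ℝ)))}

/-- All vectors obtained from the table by relabelling the states and reversing time. -/
def facetVectors (T : ℕ) : Set (Transition → ℝ) :=
  {c | ∃ b ∈ tableVectors T, ∃ σ : Equiv.Perm (Fin 3),
    c = relabel σ b ∨ c = reverse (relabel σ b)}

/-- The subset of `P` on which the inequality `c ⬝ᵥ x ≥ 0` is an equality. -/
def tightSet (P : Set (Transition → ℝ)) (c : Transition → ℝ) : Set (Transition → ℝ) :=
  {x | x ∈ P ∧ c ⬝ᵥ x = 0}

end THMC

/-! Put n = T - 1. The transition counts of a word are nonnegative integers with sum n whose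
divergence (outflow minus inflow) at each state is -1, 0 or 1. Conversely, every such integer
vector, a flow, comes from a word: on three states Euler's connectivity condition is nearly
automatic (`isFlow_countZ`, `exists_word_of_isFlow`). So the polytope is the convex hull of the
flows.

Since the counts sum to n, every table vector is on flows a positive multiple of an integral affine
form (`IsForm`). These forms are nonnegative by the divergence bounds, sharpened where necessary by
congruences modulo 2 or 3 (`IsForm.nonneg`). Five explicit flows on each hyperplane are affinely
independent (`IsForm.hasFrame`), so each tight set has dimension 4 in a polytope of dimension 5.

The core is completeness (`Setup.covered`): whatever nonconstant weight is minimised, all optimal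
flows lie on one hyperplane of the list. Subtracting a constant from all six weights shifts every
cost equally, so the least mean weight of the five simple cycles may be taken to be 0. After
splitting off a potential, the cost is the pairing of the potential with the divergence, which has
only seven possible values, plus charges on edges outside the zero cycles. Optimality leaves few
charged edges, and their number is tied to n and the divergence modulo 2 or 3. The cases are a zero
3-cycle (`Setup.covered_threeCycle`), two zero 2-cycles with positive 3-cycles
(`Setup.covered_twoTwoCycles`), and a single zero 2-cycle (`Setup.covered_oneTwoCycle`). In each,
the finitely many candidate values of the minimum are compared with bounds attained by explicit
flows; either some edge is unused by all optimal flows or they satisfy another equation of the list.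
A facet therefore lies in the tight set of a facet vector, and equality of dimensions makes the two
equal.

Two facet vectors with the same tight set are positive multiples of each other
(`exists_smul_of_tightSet_eq`). The signs and the order of the entries survive positive scaling and
take finitely many patterns, independently of the size of T. Comparing them shows that proportional
vectors are equal and that there are 24, six for each of the four rows present. -/

namespace THMC

/-! ### Flows, target hyperplanes and weighted setups -/

/-- Six integers, listed as `x₁₂, x₁₃, x₂₁, x₂₃, x₃₁, x₃₂`, that are nonnegative, sum up to `n`
and whose divergence at each state is at most one in absolute value. -/
def FlowT (n a b c d e f : ℤ) : Prop :=
  (0 ≤ a ∧ 0 ≤ b ∧ 0 ≤ c ∧ 0 ≤ d ∧ 0 ≤ e ∧ 0 ≤ f) ∧ a + b + c + d + e + f = n ∧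
  (-1 ≤ a + b - c - e ∧ a + b - c - e ≤ 1) ∧ (-1 ≤ c + d - a - f ∧ c + d - a - f ≤ 1) ∧
  (-1 ≤ e + f - b - d ∧ e + f - b - d ≤ 1)

/-- All members of `O` lie on one of the hyperplanes of the list of facets. -/
def Covered (n : ℤ) (O : (Fin 3 → Fin 3 → ℤ) → Prop) : Prop :=
  ∃ i j k : Fin 3, i ≠ j ∧ i ≠ k ∧ j ≠ k ∧
    ((∀ z, O z → z i j = 0) ∨
    (∀ z, O z → z i j + z i k - z j i - z k i = 1) ∨
    (∀ z, O z → z j i + z k i - z i j - z i k = 1) ∨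
    (n % 2 = 0 ∧ ∀ z, O z → 2 * (z i j + z i k) = n) ∨
    (n % 2 = 0 ∧ ∀ z, O z → 2 * (z j i + z k i) = n) ∨
    (n % 2 = 1 ∧ ∀ z, O z → 2 * (2 * z i j + z i k + z k j) = n - 1) ∨
    (n % 3 ≠ 2 ∧ ∀ z, O z → z i j + z k i + z k j = n / 3) ∨
    (n % 3 = 2 ∧ ∀ z, O z →
      3 * (3 * z i j + 2 * z i k + z j k + z k i + 2 * z k j) = 4 * n - 2))

/-- `m` is a lower bound for a weight on the flows of length `n`, and it is attained on `O`. -/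
structure Setup (n : ℤ) (m : ℝ) (O : (Fin 3 → Fin 3 → ℤ) → Prop) (i j k : Fin 3)
    (wij wik wji wjk wki wkj : ℝ) : Prop where
  hij : i ≠ j
  hik : i ≠ k
  hjk : j ≠ k
  lower : ∀ a b c d e f : ℤ, FlowT n a b c d e f →
    m ≤ wij * a + wik * b + wji * c + wjk * d + wki * e + wkj * f
  opt : ∀ z, O z → FlowT n (z i j) (z i k) (z j i) (z j k) (z k i) (z k j) ∧
    wij * z i j + wik * z i k + wji * z j i + wjk * z j k + wki * z k i + wkj * z k j = m

section Core

variable {n : ℤ} {m : ℝ} {O : (Fin 3 → Fin 3 → ℤ) → Prop} {i j k : Fin 3}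
  {wij wik wji wjk wki wkj : ℝ}

/-- Renaming the states only permutes the arguments of `Setup`. Together with `Setup.rotate` this is
what allows normalising assumptions on i, j, k in the case analysis. -/
theorem Setup.swap (S : Setup n m O i j k wij wik wji wjk wki wkj) :
    Setup n m O j i k wji wjk wij wik wkj wki where
  hij := S.hij.symm
  hik := S.hjk
  hjk := S.hik
  lower a b c d e f h := by
    have := S.lower c d a b f e (by unfold FlowT at h ⊢; omega)
    linarith
  opt z hz := by
    obtain ⟨h, h'⟩ := S.opt z hz
    exact ⟨by unfold FlowT at h ⊢; omega, by linarith⟩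

theorem Setup.rotate (S : Setup n m O i j k wij wik wji wjk wki wkj) :
    Setup n m O j k i wjk wji wkj wki wij wik where
  hij := S.hjk
  hik := S.hij.symm
  hjk := S.hik.symm
  lower a b c d e f h := by
    have := S.lower e f b a d c (by unfold FlowT at h ⊢; omega)
    linarith
  opt z hz := by
    obtain ⟨h, h'⟩ := S.opt z hz
    exact ⟨by unfold FlowT at h ⊢; omega, by linarith⟩

theorem Setup.congr {wij' wik' wji' wjk' wki' wkj' : ℝ}
    (S : Setup n m O i j k wij wik wji wjk wki wkj) (h₁ : wij = wij') (h₂ : wik = wik')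
    (h₃ : wji = wji') (h₄ : wjk = wjk') (h₅ : wki = wki') (h₆ : wkj = wkj') :
    Setup n m O i j k wij' wik' wji' wjk' wki' wkj' := by
  subst h₁ h₂ h₃ h₄ h₅ h₆; exact S

/-! ### Weights with a zero 3-cycle -/

section ThreeCycle

/-- The number `r ≤ 2` of backward edges is determined modulo `3` by the divergence. -/
def HexHeight (n r di dj : ℤ) : Prop :=
  0 ≤ r ∧ r ≤ 2 ∧ (-1 ≤ di ∧ di ≤ 1) ∧ (-1 ≤ dj ∧ dj ≤ 1) ∧ (-1 ≤ di + dj ∧ di + dj ≤ 1) ∧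
    (n - di + dj + r) % 3 = 0

/-- In this and the next two lists, the cases that lie on the hyperplane used for that residue of n
come first; the later ones have to be excluded by comparing costs. -/
theorem HexHeight.cases_zero {n r di dj : ℤ} (h : HexHeight n r di dj) (hn : n % 3 = 0) :
    (di = 0 ∧ dj = 0 ∧ r = 0) ∨ (di = -1 ∧ dj = 1 ∧ r = 1) ∨
      (di = 1 ∧ dj = 0 ∧ r = 1) ∨ (di = 0 ∧ dj = 1 ∧ r = 2) ∨ (di = 1 ∧ dj = -1 ∧ r = 2) ∨
      (di = -1 ∧ dj = 0 ∧ r = 2) ∨ (di = 0 ∧ dj = -1 ∧ r = 1) := by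
  unfold HexHeight at h; omega

theorem HexHeight.cases_one {n r di dj : ℤ} (h : HexHeight n r di dj) (hn : n % 3 = 1) :
    (di = -1 ∧ dj = 1 ∧ r = 0) ∨ (di = 1 ∧ dj = 0 ∧ r = 0) ∨
      (di = 0 ∧ dj = 1 ∧ r = 1) ∨ (di = 0 ∧ dj = -1 ∧ r = 0) ∨ (di = 0 ∧ dj = 0 ∧ r = 2) ∨
      (di = 1 ∧ dj = -1 ∧ r = 1) ∨ (di = -1 ∧ dj = 0 ∧ r = 1) := by
  unfold HexHeight at h; omega

theorem HexHeight.cases_two {n r di dj : ℤ} (h : HexHeight n r di dj) (hn : n % 3 = 2) :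
    (di = -1 ∧ dj = 1 ∧ r = 2) ∨ (di = -1 ∧ dj = 0 ∧ r = 0) ∨
      (di = 0 ∧ dj = 1 ∧ r = 0) ∨ (di = 1 ∧ dj = -1 ∧ r = 0) ∨ (di = 0 ∧ dj = 0 ∧ r = 1) ∨
      (di = 1 ∧ dj = 0 ∧ r = 2) ∨ (di = 0 ∧ dj = -1 ∧ r = 2) := by
  unfold HexHeight at h; omega

variable {a b c p q s : ℝ}

/-- The cycle i → k → j → i has weight zero, with potentials p, q, s at i, j, k; the backward edges
i → j, j → k, k → i carry the extra charges a, b, c. The backward counts, the divergence and the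
count f of j → i determine the flow, and the potentials enter the cost only through the divergence.
-/
theorem Setup.threeCycle_lower
    (S : Setup n m O i j k (a + p - q) (p - s) (q - p) (b + q - s) (c + s - p) (s - q))
    (yij yjk yki di dj f : ℤ)
    (h : FlowT n yij (f + di - yij + yki) f yjk yki (f + yjk - yij - dj)) :
    m ≤ a * yij + b * yjk + c * yki + p * di + q * dj + s * (-di - dj) := by
  have := S.lower _ _ _ _ _ _ h
  push_cast at this
  linarith

/-- All r backward edges are put on i → j. The length then determines f, integral by `hmod`; with
this congruence, n ≥ 4 suffices to keep the forward counts nonnegative. -/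
theorem Setup.threeCycle_lower_first (hn : 4 ≤ n)
    (S : Setup n m O i j k (a + p - q) (p - s) (q - p) (b + q - s) (c + s - p) (s - q))
    (r di dj : ℤ) (hr : 0 ≤ r) (hr' : r ≤ 2) (h₁ : -1 ≤ di ∧ di ≤ 1) (h₂ : -1 ≤ dj ∧ dj ≤ 1)
    (h₃ : -1 ≤ di + dj ∧ di + dj ≤ 1) (hmod : (n - di + dj + r) % 3 = 0) :
    m ≤ a * r + p * di + q * dj + s * (-di - dj) := by
  have := S.threeCycle_lower r 0 0 di dj ((n - di + dj + r) / 3)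
    (by unfold FlowT; omega)
  push_cast at this
  linarith

/-- If the cheapest backward edge of the zero 3-cycle costs `a > 0`, then optimal flows have at
most two backward edges, all of them of cost `a`. -/
theorem Setup.threeCycle_opt (hn : 4 ≤ n)
    (S : Setup n m O i j k (a + p - q) (p - s) (q - p) (b + q - s) (c + s - p) (s - q))
    (ha : 0 < a) (hb : a ≤ b) (hc : a ≤ c) {z : Fin 3 → Fin 3 → ℤ} (hz : O z) :
    ∃ r di dj : ℤ, r = z i j + z j k + z k i ∧ di = z i j + z i k - z j i - z k i ∧
      dj = z j i + z j k - z i j - z k j ∧ HexHeight n r di dj ∧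
      a * r + p * di + q * dj + s * (-di - dj) = m ∧
      (b - a) * z j k = 0 ∧ (c - a) * z k i = 0 := by
  obtain ⟨h, h'⟩ := S.opt z hz
  unfold FlowT at h
  -- The competitor has the same divergence, its number of backward edges is reduced modulo 3, and
  -- all of them are moved to the cheapest edge i → j.
  have h0 := S.threeCycle_lower_first hn ((z i j + z j k + z k i) % 3)
    (z i j + z i k - z j i - z k i) (z j i + z j k - z i j - z k j)
    (by omega) (by omega) (by omega) (by omega) (by omega) (by omega)
  have hjk : (0 : ℝ) ≤ z j k := by exact_mod_cast h.1.2.2.2.1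
  have hki : (0 : ℝ) ≤ z k i := by exact_mod_cast h.1.2.2.2.2.1
  have e1 : 0 ≤ (b - a) * z j k := mul_nonneg (by linarith) hjk
  have e2 : 0 ≤ (c - a) * z k i := mul_nonneg (by linarith) hki
  have hle : a * (z i j + z j k + z k i : ℤ) ≤ a * ((z i j + z j k + z k i) % 3 : ℤ) := by
    push_cast at h0 ⊢
    linarith
  have hle' : z i j + z j k + z k i ≤ (z i j + z j k + z k i) % 3 := by
    exact_mod_cast le_of_mul_le_mul_left hle ha
  have heq : (z i j + z j k + z k i) % 3 = z i j + z j k + z k i := by omega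
  rw [heq] at h0
  push_cast at h0
  refine ⟨_, _, _, rfl, rfl, rfl, by unfold HexHeight; omega, ?_, ?_, ?_⟩
  · push_cast; linarith
  · linarith
  · linarith

/-- With equal charges, the cost depends only on the divergence, since that fixes r. The
normalisation makes k → j the heaviest forward edge; the divergences off the hyperplane then cost
more than one of the bounds on m, apart from the degenerate case treated separately. -/
theorem Setup.covered_threeCycle_uniform_aux (hn : 4 ≤ n)
    (S : Setup n m O i j k (a + p - q) (p - s) (q - p) (a + q - s) (a + s - p) (s - q))
    (ha : 0 < a) (hmod : n % 3 ≠ 2) (h₁ : q - p ≤ s - q) (h₂ : p - s ≤ s - q) :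
    Covered n O := by
  have L := fun r di dj => S.threeCycle_lower_first hn r di dj
  rcases (show n % 3 = 0 ∨ n % 3 = 1 by omega) with h0 | h0
  · have l1 := L 0 0 0 (by omega) (by omega) (by omega) (by omega) (by omega) (by omega)
    have l2 := L 2 1 (-1) (by omega) (by omega) (by omega) (by omega) (by omega) (by omega)
    have l3 := L 1 (-1) 1 (by omega) (by omega) (by omega) (by omega) (by omega) (by omega)
    have l4 := L 1 1 0 (by omega) (by omega) (by omega) (by omega) (by omega) (by omega)
    push_cast at l1 l2 l3 l4
    refine ⟨i, j, k, S.hij, S.hik, S.hjk, ?_⟩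
    iterate 6 right
    left
    refine ⟨hmod, fun z hz => ?_⟩
    obtain ⟨r, di, dj, hr, hdi, hdj, hh, he, -, -⟩ := S.threeCycle_opt hn ha le_rfl le_rfl hz
    have hf := (S.opt z hz).1
    unfold FlowT at hf
    rcases hh.cases_zero h0 with
      H | H | H | H | H | H | H
    iterate 4 omega
    all_goals
      obtain ⟨rfl, rfl, H⟩ := H
      rw [H] at he
      push_cast at he
      exfalso
      linarith
  · have l1 := L 0 (-1) 1 (by omega) (by omega) (by omega) (by omega) (by omega) (by omega)
    have l2 := L 0 1 0 (by omega) (by omega) (by omega) (by omega) (by omega) (by omega)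
    have l3 := L 0 0 (-1) (by omega) (by omega) (by omega) (by omega) (by omega) (by omega)
    push_cast at l1 l2 l3
    -- The bounds `l1`, `l2`, `l3` say that m is at most each of the three forward weights, which
    -- sum to zero. If m equals the largest of them, all three vanish, and optimal flows use no
    -- backward edge.
    by_cases hms : m = s - q
    · refine ⟨i, j, k, S.hij, S.hik, S.hjk, Or.inl fun z hz => ?_⟩
      obtain ⟨r, di, dj, hr, hdi, hdj, hh, he, -, -⟩ :=
        S.threeCycle_opt hn ha le_rfl le_rfl hz
      have hf := (S.opt z hz).1
      unfold FlowT at hf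
      have e1 : s = q := by linarith
      have e2 : p = q := by linarith
      subst e1 e2
      have : (r : ℝ) = 0 := by
        have : a * r = 0 := by linarith
        rcases mul_eq_zero.1 this with h | h
        · linarith
        · exact h
      have : r = 0 := by exact_mod_cast this
      omega
    · refine ⟨i, j, k, S.hij, S.hik, S.hjk, ?_⟩
      iterate 6 right
      left
      refine ⟨hmod, fun z hz => ?_⟩
      obtain ⟨r, di, dj, hr, hdi, hdj, hh, he, -, -⟩ :=
        S.threeCycle_opt hn ha le_rfl le_rfl hz
      have hf := (S.opt z hz).1
      unfold FlowT at hf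
      rcases hh.cases_one h0 with
        H | H | H | H | H | H | H
      iterate 3 omega
      all_goals
        obtain ⟨rfl, rfl, H⟩ := H
        rw [H] at he
        push_cast at he
        exfalso
      · exact hms (by linarith)
      all_goals linarith

/-- For n ≡ 2 modulo 3 the unavoidable divergences have the opposite sign, so here it is the
lightest forward edge, j → i, that is singled out. -/
theorem Setup.covered_threeCycle_uniform_aux' (hn : 4 ≤ n)
    (S : Setup n m O i j k (a + p - q) (p - s) (q - p) (a + q - s) (a + s - p) (s - q))
    (ha : 0 < a) (hmod : n % 3 = 2) (h₁ : q - p ≤ s - q) (h₂ : q - p ≤ p - s) :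
    Covered n O := by
  have L := fun r di dj => S.threeCycle_lower_first hn r di dj
  have l1 := L 0 1 (-1) (by omega) (by omega) (by omega) (by omega) (by omega) (by omega)
  have l2 := L 0 (-1) 0 (by omega) (by omega) (by omega) (by omega) (by omega) (by omega)
  have l3 := L 0 0 1 (by omega) (by omega) (by omega) (by omega) (by omega) (by omega)
  have l4 := L 2 (-1) 1 (by omega) (by omega) (by omega) (by omega) (by omega) (by omega)
  push_cast at l1 l2 l3 l4
  -- Now m is at most each of the negated forward weights, which sum to zero; p - q is the largest
  -- of these, so equality makes all of them vanish.
  by_cases hms : m = p - q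
  · refine ⟨i, j, k, S.hij, S.hik, S.hjk, Or.inl fun z hz => ?_⟩
    obtain ⟨r, di, dj, hr, hdi, hdj, hh, he, -, -⟩ :=
      S.threeCycle_opt hn ha le_rfl le_rfl hz
    have hf := (S.opt z hz).1
    unfold FlowT at hf
    have e1 : s = q := by linarith
    have e2 : p = q := by linarith
    subst e1 e2
    have : (r : ℝ) = 0 := by
      have : a * r = 0 := by linarith
      rcases mul_eq_zero.1 this with h | h
      · linarith
      · exact h
    have : r = 0 := by exact_mod_cast this
    omega
  · refine ⟨i, j, k, S.hij, S.hik, S.hjk, ?_⟩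
    iterate 7 right
    refine ⟨hmod, fun z hz => ?_⟩
    obtain ⟨r, di, dj, hr, hdi, hdj, hh, he, -, -⟩ :=
      S.threeCycle_opt hn ha le_rfl le_rfl hz
    have hf := (S.opt z hz).1
    unfold FlowT at hf
    rcases hh.cases_two hmod with
      H | H | H | H | H | H | H
    iterate 3 omega
    all_goals
      obtain ⟨rfl, rfl, H⟩ := H
      rw [H] at he
      push_cast at he
      exfalso
    · exact hms (by linarith)
    all_goals linarith

end ThreeCycle
end Core

section Core

variable {n : ℤ} {m : ℝ} {O : (Fin 3 → Fin 3 → ℤ) → Prop} {i j k : Fin 3}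
  {wij wik wji wjk wki wkj : ℝ}

theorem min_of_three (x y z : ℝ) : (x ≤ y ∧ x ≤ z) ∨ (y ≤ z ∧ y ≤ x) ∨ (z ≤ x ∧ z ≤ y) := by
  grind

section ThreeCycle

variable {a b c p q s : ℝ}

theorem Setup.covered_threeCycle_uniform (hn : 4 ≤ n)
    (S : Setup n m O i j k (a + p - q) (p - s) (q - p) (a + q - s) (a + s - p) (s - q))
    (ha : 0 < a) : Covered n O := by
  by_cases hmod : n % 3 = 2
  · rcases min_of_three (q - p) (s - q) (p - s) with h | h | h
    · exact S.covered_threeCycle_uniform_aux' hn ha hmod h.1 h.2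
    · exact S.rotate.covered_threeCycle_uniform_aux' hn ha hmod h.1 h.2
    · exact S.rotate.rotate.covered_threeCycle_uniform_aux' hn ha hmod h.1 h.2
  · rcases min_of_three (-(q - p)) (-(s - q)) (-(p - s)) with h | h | h
    · exact S.rotate.rotate.covered_threeCycle_uniform_aux hn ha hmod (by linarith) (by linarith)
    · exact S.covered_threeCycle_uniform_aux hn ha hmod (by linarith) (by linarith)
    · exact S.rotate.covered_threeCycle_uniform_aux hn ha hmod (by linarith) (by linarith)

theorem Setup.covered_threeCycle_pos (hn : 4 ≤ n)
    (S : Setup n m O i j k (a + p - q) (p - s) (q - p) (b + q - s) (c + s - p) (s - q))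
    (ha : 0 < a) (hb : a ≤ b) (hc : a ≤ c) : Covered n O := by
  rcases hb.lt_or_eq with hb' | rfl
  · refine ⟨j, k, i, S.hjk, S.hij.symm, S.hik.symm, Or.inl fun z hz => ?_⟩
    obtain ⟨r, di, dj, -, -, -, -, -, h, -⟩ := S.threeCycle_opt hn ha hb hc hz
    rcases mul_eq_zero.1 h with h | h
    · linarith
    · exact_mod_cast h
  rcases hc.lt_or_eq with hc' | rfl
  · refine ⟨k, i, j, S.hik.symm, S.hjk.symm, S.hij, Or.inl fun z hz => ?_⟩
    obtain ⟨r, di, dj, -, -, -, -, -, -, h⟩ := S.threeCycle_opt hn ha hb hc hz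
    rcases mul_eq_zero.1 h with h | h
    · linarith
    · exact_mod_cast h
  exact S.covered_threeCycle_uniform hn ha

theorem hex_cases {di dj : ℤ} (h₁ : -1 ≤ di ∧ di ≤ 1) (h₂ : -1 ≤ dj ∧ dj ≤ 1)
    (h₃ : -1 ≤ di + dj ∧ di + dj ≤ 1) :
    (di = 0 ∧ dj = 0) ∨ (di = 1 ∧ dj = -1) ∨ (di = -1 ∧ dj = 1) ∨ (di = 1 ∧ dj = 0) ∨
      (di = -1 ∧ dj = 0) ∨ (di = 0 ∧ dj = 1) ∨ (di = 0 ∧ dj = -1) := by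
  omega

/-- When i → j carries no charge, the residue of r modulo 3 costs nothing, so each of the seven
divergences is attained at its potential cost alone. -/
theorem Setup.threeCycle_zero_lower (hn : 4 ≤ n)
    (S : Setup n m O i j k (p - q) (p - s) (q - p) (b + q - s) (c + s - p) (s - q))
    (di dj : ℤ) (h₁ : -1 ≤ di ∧ di ≤ 1) (h₂ : -1 ≤ dj ∧ dj ≤ 1)
    (h₃ : -1 ≤ di + dj ∧ di + dj ≤ 1) : m ≤ p * di + q * dj + s * (-di - dj) := by
  have S' : Setup n m O i j k (0 + p - q) (p - s) (q - p) (b + q - s) (c + s - p) (s - q) :=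
    S.congr (by ring) rfl rfl rfl rfl rfl
  have := S'.threeCycle_lower_first hn ((-n + di - dj) % 3) di dj (by omega) (by omega)
    h₁ h₂ h₃ (by omega)
  linarith

/-- The cost is the potential at the source minus that at the sink. If the potential at i is the
unique minimum, i must be the source of every optimal flow; if it is the unique maximum, the sink.
-/
theorem Setup.covered_potential_of_extreme (hn : 4 ≤ n)
    (S : Setup n m O i j k (p - q) (p - s) (q - p) (q - s) (s - p) (s - q))
    (h : p < q ∧ p < s ∨ q < p ∧ s < p) : Covered n O := by
  have S' : Setup n m O i j k (p - q) (p - s) (q - p) (0 + q - s) (0 + s - p) (s - q) :=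
    S.congr rfl rfl rfl (by ring) (by ring) rfl
  have L := S'.threeCycle_zero_lower hn
  have l1 := L 1 (-1) (by omega) (by omega) (by omega)
  have l2 := L (-1) 1 (by omega) (by omega) (by omega)
  have l3 := L 1 0 (by omega) (by omega) (by omega)
  have l4 := L (-1) 0 (by omega) (by omega) (by omega)
  push_cast at l1 l2 l3 l4
  have V : ∀ z, O z → p * (z i j + z i k - z j i - z k i : ℤ) +
      q * (z j i + z j k - z i j - z k j : ℤ) + s * (-(z i j + z i k - z j i - z k i : ℤ) -
      (z j i + z j k - z i j - z k j : ℤ)) = m ∧ _ := fun z hz => by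
    obtain ⟨h, h'⟩ := S.opt z hz
    unfold FlowT at h
    have H := @hex_cases (z i j + z i k - z j i - z k i) (z j i + z j k - z i j - z k j)
      (by omega) (by omega) (by omega)
    exact ⟨by push_cast; linarith, H⟩
  rcases h with h | h
  · refine ⟨i, j, k, S.hij, S.hik, S.hjk, Or.inr <| Or.inl fun z hz => ?_⟩
    obtain ⟨hv, H⟩ := V z hz
    generalize z i j + z i k - z j i - z k i = di at *
    generalize z j i + z j k - z i j - z k j = dj at *
    rcases H with ⟨rfl, rfl⟩ | ⟨rfl, rfl⟩ | ⟨rfl, rfl⟩ | ⟨rfl, rfl⟩ | ⟨rfl, rfl⟩ | ⟨rfl, rfl⟩ |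
      ⟨rfl, rfl⟩
    all_goals first | rfl | (exfalso; push_cast at hv; linarith)
  · refine ⟨i, j, k, S.hij, S.hik, S.hjk, Or.inr <| Or.inr <| Or.inl fun z hz => ?_⟩
    suffices z i j + z i k - z j i - z k i = -1 by omega
    obtain ⟨hv, H⟩ := V z hz
    generalize z i j + z i k - z j i - z k i = di at *
    generalize z j i + z j k - z i j - z k j = dj at *
    rcases H with ⟨rfl, rfl⟩ | ⟨rfl, rfl⟩ | ⟨rfl, rfl⟩ | ⟨rfl, rfl⟩ | ⟨rfl, rfl⟩ | ⟨rfl, rfl⟩ |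
      ⟨rfl, rfl⟩
    all_goals first | rfl | (exfalso; push_cast at hv; linarith)

/-- If the weight is a potential, then the optimal flows have their sources, or their sinks, at
one state. -/
theorem Setup.covered_potential (hn : 4 ≤ n)
    (S : Setup n m O i j k (p - q) (p - s) (q - p) (q - s) (s - p) (s - q))
    (hne : ∃ a b c d e f : ℤ, FlowT n a b c d e f ∧
      m < (p - q) * a + (p - s) * b + (q - p) * c + (q - s) * d + (s - p) * e + (s - q) * f) :
    Covered n O := by
  by_cases h₁ : p < q ∧ p < s ∨ q < p ∧ s < p
  · exact S.covered_potential_of_extreme hn h₁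
  by_cases h₂ : q < p ∧ q < s ∨ p < q ∧ s < q
  · exact S.swap.covered_potential_of_extreme hn h₂
  by_cases h₃ : s < p ∧ s < q ∨ p < s ∧ q < s
  · exact S.rotate.rotate.covered_potential_of_extreme hn h₃
  -- Three numbers without a strict minimum or strict maximum are equal. Then every flow costs 0
  -- whereas m < 0, so `O` is empty.
  obtain ⟨rfl, rfl⟩ : p = q ∧ p = s := by grind
  obtain ⟨a, b, c, d, e, f, -, hlt⟩ := hne
  refine ⟨i, j, k, S.hij, S.hik, S.hjk, Or.inl fun z hz => ?_⟩
  have := (S.opt z hz).2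
  simp only [sub_self, zero_mul, add_zero] at hlt this
  linarith

/-- The potential part of the cost is already at least m, so an edge with a positive charge is
unused. If there is none, the weight is a potential. -/
theorem Setup.covered_threeCycle_zero (hn : 4 ≤ n)
    (S : Setup n m O i j k (p - q) (p - s) (q - p) (b + q - s) (c + s - p) (s - q))
    (hb : 0 ≤ b) (hc : 0 ≤ c)
    (hne : ∃ a' b' c' d e f : ℤ, FlowT n a' b' c' d e f ∧ m < (p - q) * a' + (p - s) * b' +
      (q - p) * c' + (b + q - s) * d + (c + s - p) * e + (s - q) * f) :
    Covered n O := by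
  have V : ∀ z, O z → b * z j k = 0 ∧ c * z k i = 0 := by
    intro z hz
    obtain ⟨h, h'⟩ := S.opt z hz
    unfold FlowT at h
    have := S.threeCycle_zero_lower hn (z i j + z i k - z j i - z k i)
      (z j i + z j k - z i j - z k j) (by omega) (by omega) (by omega)
    have h1 : (0 : ℝ) ≤ z j k := by exact_mod_cast h.1.2.2.2.1
    have h2 : (0 : ℝ) ≤ z k i := by exact_mod_cast h.1.2.2.2.2.1
    have := mul_nonneg hb h1
    have := mul_nonneg hc h2
    push_cast at *
    constructor <;> linarith
  rcases hb.lt_or_eq with hb' | rfl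
  · refine ⟨j, k, i, S.hjk, S.hij.symm, S.hik.symm, Or.inl fun z hz => ?_⟩
    rcases mul_eq_zero.1 (V z hz).1 with h | h
    · linarith
    · exact_mod_cast h
  rcases hc.lt_or_eq with hc' | rfl
  · refine ⟨k, i, j, S.hik.symm, S.hjk.symm, S.hij, Or.inl fun z hz => ?_⟩
    rcases mul_eq_zero.1 (V z hz).2 with h | h
    · linarith
    · exact_mod_cast h
  simp only [zero_add] at S hne
  exact S.covered_potential hn hne

end ThreeCycle

/-- The zero 3-cycle makes its three edge weights differences of a potential, normalised to 0 at i.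
The charge of a backward edge is the weight of the 2-cycle through it, and i → j is assumed to have
the least one. -/
theorem Setup.covered_threeCycle_aux (hn : 4 ≤ n)
    (S : Setup n m O i j k wij wik wji wjk wki wkj) (h : wik + wkj + wji = 0)
    (ha : 0 ≤ wij + wji) (hb : wij + wji ≤ wjk + wkj) (hc : wij + wji ≤ wki + wik)
    (hne : ∃ a b c d e f : ℤ, FlowT n a b c d e f ∧
      m < wij * a + wik * b + wji * c + wjk * d + wki * e + wkj * f) :
    Covered n O := by
  rcases ha.lt_or_eq with ha' | ha'
  · refine Setup.covered_threeCycle_pos (m := m) (i := i) (j := j) (k := k)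
      (a := wij + wji) (b := wjk + wkj) (c := wki + wik)
      (p := 0) (q := wji) (s := -wik) hn ?_ ha' hb hc
    apply S.congr <;> linarith
  · refine Setup.covered_threeCycle_zero (m := m) (i := i) (j := j) (k := k)
      (b := wjk + wkj) (c := wki + wik)
      (p := 0) (q := wji) (s := -wik) hn ?_ (by linarith) (by linarith) ?_
    · apply S.congr <;> linarith
    · obtain ⟨a, b, c, d, e, f, hf, hlt⟩ := hne
      refine ⟨a, b, c, d, e, f, hf, hlt.trans_eq ?_⟩
      obtain rfl : wij = -wji := by linarith
      obtain rfl : wik = -wkj - wji := by linarith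
      ring

theorem Setup.rotate_ne (hne : ∃ a b c d e f : ℤ, FlowT n a b c d e f ∧
      m < wij * a + wik * b + wji * c + wjk * d + wki * e + wkj * f) :
    ∃ a b c d e f : ℤ, FlowT n a b c d e f ∧
      m < wjk * a + wji * b + wkj * c + wki * d + wij * e + wik * f := by
  obtain ⟨a, b, c, d, e, f, hf, hlt⟩ := hne
  exact ⟨d, c, f, e, a, b, by unfold FlowT at hf ⊢; omega, by linarith⟩

theorem Setup.covered_threeCycle (hn : 4 ≤ n)
    (S : Setup n m O i j k wij wik wji wjk wki wkj) (h : wik + wkj + wji = 0)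
    (ha : 0 ≤ wij + wji) (hb : 0 ≤ wjk + wkj) (hc : 0 ≤ wki + wik)
    (hne : ∃ a b c d e f : ℤ, FlowT n a b c d e f ∧
      m < wij * a + wik * b + wji * c + wjk * d + wki * e + wkj * f) :
    Covered n O := by
  rcases min_of_three (wij + wji) (wjk + wkj) (wki + wik) with h' | h' | h'
  · exact S.covered_threeCycle_aux hn h ha h'.1 h'.2 hne
  · exact S.rotate.covered_threeCycle_aux hn (by linarith) hb h'.1 h'.2 (Setup.rotate_ne hne)
  · exact S.rotate.rotate.covered_threeCycle_aux hn (by linarith) hc h'.1 h'.2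
      (Setup.rotate_ne (Setup.rotate_ne hne))

/-! ### Two zero 2-cycles and positive 3-cycles -/

section TwoTwoCycles

variable {a b p s : ℝ}

/-- The 2-cycles through j have weight zero, with potentials p, 0, s at i, j, k; the edges i → k and
k → i carry charges a and b, the weights of the 3-cycles through them. -/
theorem Setup.twoTwoCycles_lower (hn : 4 ≤ n)
    (S : Setup n m O i j k p (a + p - s) (-p) (-s) (b + s - p) s)
    (yik yki di dk : ℤ) (hik : 0 ≤ yik) (hki : 0 ≤ yki) (hr : yik + yki ≤ 1)
    (h₁ : -1 ≤ di ∧ di ≤ 1) (h₂ : -1 ≤ dk ∧ dk ≤ 1) (h₃ : -1 ≤ di + dk ∧ di + dk ≤ 1)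
    (hmod : (n - yik - yki + di + dk) % 2 = 0) :
    m ≤ a * yik + b * yki + p * di + s * dk := by
  -- Of the edges k → j and j → k at most one is used, just often enough to give k its divergence.
  -- The 2-cycle on i and j fills up the length, the parity being right by `hmod`.
  obtain ⟨x, y, hx, hy, hxy, hle⟩ : ∃ x y : ℤ, 0 ≤ x ∧ 0 ≤ y ∧ x - y = dk - yki + yik ∧
      x + y ≤ 2 ∧ x * y = 0 := by
    rcases le_total 0 (dk - yki + yik) with h | h
    · exact ⟨dk - yki + yik, 0, h, le_rfl, by omega, by omega, by simp⟩
    · exact ⟨0, -(dk - yki + yik), le_rfl, by omega, by omega, by omega, by simp⟩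
  obtain ⟨u, hu⟩ : ∃ u, 2 * u = n - yik - yki - x - y + di - yik + yki :=
    ⟨(n - yik - yki - x - y + di - yik + yki) / 2, by omega⟩
  have hxy' : (y : ℝ) = x - dk + yki - yik := by
    have : y = x - dk + yki - yik := by omega
    exact_mod_cast this
  have := S.lower u yik (u - di + yik - yki) y yki x (by unfold FlowT; omega)
  push_cast at this
  rw [hxy'] at this
  linarith

theorem Setup.twoTwoCycles_opt (hn : 4 ≤ n)
    (S : Setup n m O i j k p (a + p - s) (-p) (-s) (b + s - p) s)
    (ha : 0 < a) (hb : a ≤ b) {z : Fin 3 → Fin 3 → ℤ} (hz : O z) :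
    ∃ r di dk : ℤ, r = z i k + z k i ∧ di = z i j + z i k - z j i - z k i ∧
      dk = z k i + z k j - z i k - z j k ∧ r = (n + di + dk) % 2 ∧
      a * r + p * di + s * dk = m ∧ (b - a) * z k i = 0 ∧
      ((di = 0 ∧ dk = 0) ∨ (di = 1 ∧ dk = -1) ∨ (di = -1 ∧ dk = 1) ∨ (di = 1 ∧ dk = 0) ∨
      (di = -1 ∧ dk = 0) ∨ (di = 0 ∧ dk = 1) ∨ (di = 0 ∧ dk = -1)) := by
  obtain ⟨h, h'⟩ := S.opt z hz
  unfold FlowT at h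
  have H := @hex_cases (z i j + z i k - z j i - z k i) (z k i + z k j - z i k - z j k)
    (by omega) (by omega) (by omega)
  -- The competitor keeps the divergence, reduces the number of charged edges modulo 2 and uses the
  -- cheaper one, i → k.
  have h0 := S.twoTwoCycles_lower hn ((z i k + z k i) % 2) 0
    (z i j + z i k - z j i - z k i) (z k i + z k j - z i k - z j k)
    (by omega) (by omega) (by omega) (by omega) (by omega) (by omega) (by omega)
  have hki : (0 : ℝ) ≤ z k i := by exact_mod_cast h.1.2.2.2.2.1
  have e : 0 ≤ (b - a) * z k i := mul_nonneg (by linarith) hki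
  have hle : a * (z i k + z k i : ℤ) ≤ a * ((z i k + z k i) % 2 : ℤ) := by
    push_cast at h0 ⊢
    linarith
  have hle' : z i k + z k i ≤ (z i k + z k i) % 2 := by
    exact_mod_cast le_of_mul_le_mul_left hle ha
  have heq : (z i k + z k i) % 2 = z i k + z k i := by omega
  rw [heq] at h0
  push_cast at h0
  refine ⟨_, _, _, rfl, rfl, rfl, by omega, ?_, ?_, H⟩
  · push_cast; linarith
  · linarith

/-- For odd n a charged edge is needed exactly when j has divergence zero. As p ≤ s, this can be
optimal only with source i and sink k, at cost a + p - s. If m has this value, the equation for odd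
n holds; otherwise i → k is never used. -/
theorem Setup.covered_twoTwoCycles_odd (hn : 4 ≤ n) (hmod : n % 2 = 1)
    (S : Setup n m O i j k p (a + p - s) (-p) (-s) (a + s - p) s) (ha : 0 < a) (hps : p ≤ s) :
    Covered n O := by
  have L := S.twoTwoCycles_lower hn 0 0
  have l1 := L 1 0 le_rfl le_rfl (by omega) (by omega) (by omega) (by omega) (by omega)
  have l2 := L (-1) 0 le_rfl le_rfl (by omega) (by omega) (by omega) (by omega) (by omega)
  have l3 := L 0 1 le_rfl le_rfl (by omega) (by omega) (by omega) (by omega) (by omega)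
  have l4 := L 0 (-1) le_rfl le_rfl (by omega) (by omega) (by omega) (by omega) (by omega)
  push_cast at l1 l2 l3 l4
  by_cases hm : m = a + p - s
  · refine ⟨k, i, j, S.hik.symm, S.hjk.symm, S.hij, ?_⟩
    iterate 5 right
    left
    refine ⟨hmod, fun z hz => ?_⟩
    obtain ⟨r, di, dk, hr, hdi, hdk, hr', he, -, H⟩ := S.twoTwoCycles_opt hn ha le_rfl hz
    have hf := (S.opt z hz).1
    unfold FlowT at hf
    rcases H with ⟨h1, h2⟩ | ⟨h1, h2⟩ | ⟨h1, h2⟩ | ⟨h1, h2⟩ | ⟨h1, h2⟩ | ⟨h1, h2⟩ | ⟨h1, h2⟩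
    · have h3 : r = 1 := by omega
      rw [h1, h2, h3] at he
      push_cast at he
      exfalso; linarith
    · omega
    · have h3 : r = 1 := by omega
      rw [h1, h2, h3] at he
      push_cast at he
      exfalso; linarith
    · omega
    · have h3 : r = 0 := by omega
      rw [h1, h2, h3] at he
      push_cast at he
      exfalso; linarith
    · have h3 : r = 0 := by omega
      rw [h1, h2, h3] at he
      push_cast at he
      exfalso; linarith
    · omega
  · refine ⟨i, k, j, S.hik, S.hij, S.hjk.symm, Or.inl fun z hz => ?_⟩
    obtain ⟨r, di, dk, hr, hdi, hdk, hr', he, -, H⟩ := S.twoTwoCycles_opt hn ha le_rfl hz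
    have hf := (S.opt z hz).1
    unfold FlowT at hf
    rcases H with ⟨h1, h2⟩ | ⟨h1, h2⟩ | ⟨h1, h2⟩ | ⟨h1, h2⟩ | ⟨h1, h2⟩ | ⟨h1, h2⟩ | ⟨h1, h2⟩
    · have h3 : r = 1 := by omega
      rw [h1, h2, h3] at he
      push_cast at he
      exfalso; linarith
    · have h3 : r = 1 := by omega
      rw [h1, h2, h3] at he
      push_cast at he
      exact absurd (by linarith) hm
    · have h3 : r = 1 := by omega
      rw [h1, h2, h3] at he
      push_cast at he
      exfalso; linarith
    all_goals omega

/-- Counting edges at j gives n = 2 · inflow(j) - (di + dk) + r = 2 · outflow(j) + (di + dk) + r,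
and r = 1 exactly when di + dk is odd. So one of the two equations holds as soon as di + dk takes
only one of the values 1 and -1 on optimal flows. -/
theorem Setup.covered_twoTwoCycles_even (hn : 4 ≤ n) (hmod : n % 2 = 0)
    (S : Setup n m O i j k p (a + p - s) (-p) (-s) (a + s - p) s) (ha : 0 < a) :
    Covered n O := by
  have L := S.twoTwoCycles_lower hn 0 0
  have l1 := L 0 0 le_rfl le_rfl (by omega) (by omega) (by omega) (by omega) (by omega)
  have l2 := L 1 (-1) le_rfl le_rfl (by omega) (by omega) (by omega) (by omega) (by omega)
  have l3 := L (-1) 1 le_rfl le_rfl (by omega) (by omega) (by omega) (by omega) (by omega)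
  push_cast at l1 l2 l3
  refine ⟨j, i, k, S.hij.symm, S.hjk, S.hik, ?_⟩
  iterate 3 right
  -- For p < a the bounds exclude di + dk = -1, and for p ≥ a they exclude di + dk = 1.
  rcases lt_or_ge p a with hpa | hpa
  · right; left
    refine ⟨hmod, fun z hz => ?_⟩
    obtain ⟨r, di, dk, hr, hdi, hdk, hr', he, -, H⟩ := S.twoTwoCycles_opt hn ha le_rfl hz
    have hf := (S.opt z hz).1
    unfold FlowT at hf
    rcases H with ⟨h1, h2⟩ | ⟨h1, h2⟩ | ⟨h1, h2⟩ | ⟨h1, h2⟩ | ⟨h1, h2⟩ | ⟨h1, h2⟩ | ⟨h1, h2⟩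
    · omega
    · omega
    · omega
    · omega
    · have h3 : r = 1 := by omega
      rw [h1, h2, h3] at he
      push_cast at he
      exfalso; linarith
    · omega
    · have h3 : r = 1 := by omega
      rw [h1, h2, h3] at he
      push_cast at he
      exfalso; linarith
  · left
    refine ⟨hmod, fun z hz => ?_⟩
    obtain ⟨r, di, dk, hr, hdi, hdk, hr', he, -, H⟩ := S.twoTwoCycles_opt hn ha le_rfl hz
    have hf := (S.opt z hz).1
    unfold FlowT at hf
    rcases H with ⟨h1, h2⟩ | ⟨h1, h2⟩ | ⟨h1, h2⟩ | ⟨h1, h2⟩ | ⟨h1, h2⟩ | ⟨h1, h2⟩ | ⟨h1, h2⟩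
    · omega
    · omega
    · omega
    · have h3 : r = 1 := by omega
      rw [h1, h2, h3] at he
      push_cast at he
      exfalso; linarith
    · omega
    · have h3 : r = 1 := by omega
      rw [h1, h2, h3] at he
      push_cast at he
      exfalso; linarith
    · omega

theorem Setup.covered_twoTwoCycles_aux (hn : 4 ≤ n)
    (S : Setup n m O i j k p (a + p - s) (-p) (-s) (b + s - p) s) (ha : 0 < a) (hb : a ≤ b) :
    Covered n O := by
  rcases hb.lt_or_eq with hb' | rfl
  · refine ⟨k, i, j, S.hik.symm, S.hjk.symm, S.hij, Or.inl fun z hz => ?_⟩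
    obtain ⟨r, di, dk, hr, hdi, hdk, hr', he, h, H⟩ := S.twoTwoCycles_opt hn ha hb hz
    rcases mul_eq_zero.1 h with h | h
    · linarith
    · exact_mod_cast h
  rcases Int.emod_two_eq_zero_or_one n with hmod | hmod
  · exact S.covered_twoTwoCycles_even hn hmod ha
  · rcases le_total p s with h | h
    · exact S.covered_twoTwoCycles_odd hn hmod ha h
    · exact S.rotate.swap.covered_twoTwoCycles_odd hn hmod ha h

end TwoTwoCycles

/-- The case of weight zero on two 2-cycles and positive weight on both 3-cycles. -/
theorem Setup.covered_twoTwoCycles (hn : 4 ≤ n)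
    (S : Setup n m O i j k wij wik wji wjk wki wkj) (h₁ : wij + wji = 0) (h₂ : wjk + wkj = 0)
    (ha : 0 < wik + wkj + wji) (hb : 0 < wij + wjk + wki) : Covered n O := by
  rcases le_total (wik + wkj + wji) (wij + wjk + wki) with h | h
  · refine Setup.covered_twoTwoCycles_aux (m := m) (i := i) (j := j) (k := k)
      (a := wik + wkj + wji) (b := wij + wjk + wki)
      (p := wij) (s := wkj) hn ?_ ha h
    apply S.congr <;> linarith
  · refine Setup.covered_twoTwoCycles_aux (m := m) (i := k) (j := j) (k := i)
      (a := wij + wjk + wki) (b := wik + wkj + wji)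
      (p := wkj) (s := wij) hn ?_ hb h
    apply S.rotate.swap.congr <;> linarith

end Core

section Core

variable {n : ℤ} {m : ℝ} {O : (Fin 3 → Fin 3 → ℤ) → Prop} {i j k : Fin 3}
  {wij wik wji wjk wki wkj : ℝ}

/-! ### A single zero cycle, of length two -/

section OneTwoCycle

variable {p u₁ u₂ v₁ v₂ : ℝ}

/-- The potential is p at i and 0 at j and k, and the four edges at k are charged. Their counts
together with the divergence at i leave only the 2-cycle on i and j to fill the remaining length. -/
theorem Setup.oneTwoCycle_lower
    (S : Setup n m O i j k p (u₁ + p) (-p) u₂ (v₁ - p) v₂) (di yik yjk yki ykj : ℤ)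
    (h : 0 ≤ yik ∧ 0 ≤ yjk ∧ 0 ≤ yki ∧ 0 ≤ ykj) (h₁ : -1 ≤ di ∧ di ≤ 1)
    (h₂ : -1 ≤ yki + ykj - yik - yjk ∧ yki + ykj - yik - yjk ≤ 1)
    (h₃ : -1 ≤ di + (yki + ykj - yik - yjk) ∧ di + (yki + ykj - yik - yjk) ≤ 1)
    (hmod : (n - yik - yjk - yki - ykj + (di - yik + yki)) % 2 = 0)
    (h₄ : 0 ≤ n - yik - yjk - yki - ykj + (di - yik + yki))
    (h₅ : 0 ≤ n - yik - yjk - yki - ykj - (di - yik + yki)) :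
    m ≤ p * di + u₁ * yik + u₂ * yjk + v₁ * yki + v₂ * ykj := by
  obtain ⟨x, hx⟩ : ∃ x, 2 * x = n - yik - yjk - yki - ykj + (di - yik + yki) :=
    ⟨(n - yik - yjk - yki - ykj + (di - yik + yki)) / 2, by omega⟩
  have := S.lower x yik (x - (di - yik + yki)) yjk yki ykj (by unfold FlowT; omega)
  push_cast at this
  linarith

/-- The ways in which an optimal flow uses the four edges at `k`. -/
def EdgeUse (ik jk ki kj : ℤ) : Prop :=
  (ik = 0 ∧ jk = 0 ∧ ki = 0 ∧ kj = 0) ∨ (ik = 1 ∧ jk = 0 ∧ ki = 0 ∧ kj = 1) ∨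
  (ik = 0 ∧ jk = 1 ∧ ki = 1 ∧ kj = 0) ∨ (ik = 1 ∧ jk = 0 ∧ ki = 0 ∧ kj = 0) ∨
  (ik = 0 ∧ jk = 2 ∧ ki = 1 ∧ kj = 0) ∨ (ik = 0 ∧ jk = 1 ∧ ki = 0 ∧ kj = 0) ∨
  (ik = 2 ∧ jk = 0 ∧ ki = 0 ∧ kj = 1) ∨ (ik = 0 ∧ jk = 0 ∧ ki = 1 ∧ kj = 0) ∨
  (ik = 1 ∧ jk = 0 ∧ ki = 0 ∧ kj = 2) ∨ (ik = 0 ∧ jk = 0 ∧ ki = 0 ∧ kj = 1) ∨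
  (ik = 0 ∧ jk = 1 ∧ ki = 2 ∧ kj = 0)

/-- The four alternatives exclude both 2-cycles through k and the double use of either 3-cycle; the
divergence bound at k leaves eleven patterns. -/
theorem edgeUse_of {ik jk ki kj : ℤ} (h : 0 ≤ ik ∧ 0 ≤ jk ∧ 0 ≤ ki ∧ 0 ≤ kj)
    (hd : -1 ≤ ki + kj - ik - jk ∧ ki + kj - ik - jk ≤ 1) (h₁ : ik = 0 ∨ ki = 0)
    (h₂ : jk = 0 ∨ kj = 0) (h₃ : ik ≤ 1 ∨ kj ≤ 1) (h₄ : jk ≤ 1 ∨ ki ≤ 1) :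
    EdgeUse ik jk ki kj := by
  rcases h₁ with rfl | rfl <;> rcases h₂ with rfl | rfl
  · rcases (show (ki = 0 ∧ kj = 0) ∨ (ki = 1 ∧ kj = 0) ∨ (ki = 0 ∧ kj = 1) by omega) with
      ⟨rfl, rfl⟩ | ⟨rfl, rfl⟩ | ⟨rfl, rfl⟩ <;> simp [EdgeUse]
  · rcases (show (jk = 0 ∧ ki = 0) ∨ (jk = 1 ∧ ki = 0) ∨ (jk = 0 ∧ ki = 1) ∨ (jk = 1 ∧ ki = 1) ∨
      (jk = 2 ∧ ki = 1) ∨ (jk = 1 ∧ ki = 2) by omega) with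
      ⟨rfl, rfl⟩ | ⟨rfl, rfl⟩ | ⟨rfl, rfl⟩ | ⟨rfl, rfl⟩ | ⟨rfl, rfl⟩ | ⟨rfl, rfl⟩ <;>
      simp [EdgeUse]
  · rcases (show (ik = 0 ∧ kj = 0) ∨ (ik = 1 ∧ kj = 0) ∨ (ik = 0 ∧ kj = 1) ∨ (ik = 1 ∧ kj = 1) ∨
      (ik = 2 ∧ kj = 1) ∨ (ik = 1 ∧ kj = 2) by omega) with
      ⟨rfl, rfl⟩ | ⟨rfl, rfl⟩ | ⟨rfl, rfl⟩ | ⟨rfl, rfl⟩ | ⟨rfl, rfl⟩ | ⟨rfl, rfl⟩ <;>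
      simp [EdgeUse]
  · rcases (show (ik = 0 ∧ jk = 0) ∨ (ik = 1 ∧ jk = 0) ∨ (ik = 0 ∧ jk = 1) by omega) with
      ⟨rfl, rfl⟩ | ⟨rfl, rfl⟩ | ⟨rfl, rfl⟩ <;> simp [EdgeUse]

/-- Exchange arguments: a 2-cycle through k can be replaced by the free 2-cycle on i and j, and two
copies of a 3-cycle by three copies of it. Each exchange keeps length and divergence and strictly
lowers the cost. -/
theorem Setup.oneTwoCycle_opt
    (S : Setup n m O i j k p (u₁ + p) (-p) u₂ (v₁ - p) v₂) (h₁₁ : 0 < u₁ + v₁) (h₂₂ : 0 < u₂ + v₂)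
    (h₁₂ : 0 < u₁ + v₂) (h₂₁ : 0 < u₂ + v₁) {z : Fin 3 → Fin 3 → ℤ} (hz : O z) :
    EdgeUse (z i k) (z j k) (z k i) (z k j) ∧
      p * (z i j + z i k - z j i - z k i) + u₁ * z i k + u₂ * z j k + v₁ * z k i + v₂ * z k j
        = m := by
  obtain ⟨h, h'⟩ := S.opt z hz
  have L := S.lower
  unfold FlowT at h
  refine ⟨edgeUse_of (by omega) (by omega) ?_ ?_ ?_ ?_, by linarith⟩
  · by_contra! hc
    have := L (z i j + 1) (z i k - 1) (z j i + 1) (z j k) (z k i - 1) (z k j)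
      (by unfold FlowT; omega)
    push_cast at this
    linarith
  · by_contra! hc
    have := L (z i j + 1) (z i k) (z j i + 1) (z j k - 1) (z k i) (z k j - 1)
      (by unfold FlowT; omega)
    push_cast at this
    linarith
  · by_contra! hc
    have := L (z i j + 3) (z i k - 2) (z j i + 1) (z j k) (z k i) (z k j - 2)
      (by unfold FlowT; omega)
    push_cast at this
    linarith
  · by_contra! hc
    have := L (z i j + 1) (z i k) (z j i + 3) (z j k - 2) (z k i - 2) (z k j)
      (by unfold FlowT; omega)
    push_cast at this
    linarith

/-- Parity of the length determines the divergence d at i from the edges used at k, except when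
these belong to a single 3-cycle: then d = 1 and d = -1 are both possible. -/
theorem Setup.oneTwoCycle_even_cases (hmod : n % 2 = 0)
    (S : Setup n m O i j k p (u₁ + p) (-p) u₂ (v₁ - p) v₂) (h₁₁ : 0 < u₁ + v₁) (h₂₂ : 0 < u₂ + v₂)
    (h₁₂ : 0 < u₁ + v₂) (h₂₁ : 0 < u₂ + v₁) {z : Fin 3 → Fin 3 → ℤ} (hz : O z) :
    ∃ d : ℤ, d = z i j + z i k - z j i - z k i ∧ (
    (d = 0 ∧ m = 0 ∧ z i k = 0 ∧ z j k = 0 ∧ z k i = 0 ∧ z k j = 0) ∨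
    (d = 1 ∧ m = u₁ + v₂ + p ∧ z i k = 1 ∧ z j k = 0 ∧ z k i = 0 ∧ z k j = 1) ∨
    (d = -1 ∧ m = u₁ + v₂ - p ∧ z i k = 1 ∧ z j k = 0 ∧ z k i = 0 ∧ z k j = 1) ∨
    (d = 1 ∧ m = u₂ + v₁ + p ∧ z i k = 0 ∧ z j k = 1 ∧ z k i = 1 ∧ z k j = 0) ∨
    (d = -1 ∧ m = u₂ + v₁ - p ∧ z i k = 0 ∧ z j k = 1 ∧ z k i = 1 ∧ z k j = 0) ∨
    (d = 0 ∧ m = u₁ ∧ z i k = 1 ∧ z j k = 0 ∧ z k i = 0 ∧ z k j = 0) ∨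
    (d = 0 ∧ m = 2 * u₂ + v₁ ∧ z i k = 0 ∧ z j k = 2 ∧ z k i = 1 ∧ z k j = 0) ∨
    (d = 1 ∧ m = u₂ + p ∧ z i k = 0 ∧ z j k = 1 ∧ z k i = 0 ∧ z k j = 0) ∨
    (d = 1 ∧ m = 2 * u₁ + v₂ + p ∧ z i k = 2 ∧ z j k = 0 ∧ z k i = 0 ∧ z k j = 1) ∨
    (d = 0 ∧ m = v₁ ∧ z i k = 0 ∧ z j k = 0 ∧ z k i = 1 ∧ z k j = 0) ∨
    (d = 0 ∧ m = u₁ + 2 * v₂ ∧ z i k = 1 ∧ z j k = 0 ∧ z k i = 0 ∧ z k j = 2) ∨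
    (d = -1 ∧ m = v₂ - p ∧ z i k = 0 ∧ z j k = 0 ∧ z k i = 0 ∧ z k j = 1) ∨
    (d = -1 ∧ m = u₂ + 2 * v₁ - p ∧ z i k = 0 ∧ z j k = 1 ∧ z k i = 2 ∧ z k j = 0)) := by
  obtain ⟨h, hv⟩ := S.oneTwoCycle_opt h₁₁ h₂₂ h₁₂ h₂₁ hz
  have hf := (S.opt z hz).1
  refine ⟨_, rfl, ?_⟩
  have hv' : p * (z i j + z i k - z j i - z k i : ℤ) + u₁ * z i k + u₂ * z j k + v₁ * z k i +
    v₂ * z k j = m := by push_cast; exact hv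
  have hd : -1 ≤ z i j + z i k - z j i - z k i ∧ z i j + z i k - z j i - z k i ≤ 1 ∧
    (n - (z i j + z i k - z j i - z k i) - z j k - z k j) % 2 = 0 ∧
    -1 ≤ (z i j + z i k - z j i - z k i) + (z k i + z k j - z i k - z j k) ∧
    (z i j + z i k - z j i - z k i) + (z k i + z k j - z i k - z j k) ≤ 1 := by
    unfold FlowT at hf; omega
  clear hv hf
  generalize z i j + z i k - z j i - z k i = d at *
  have key : ∀ e : ℤ, d = e → m = p * e + u₁ * z i k + u₂ * z j k + v₁ * z k i + v₂ * z k j := by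
    rintro e rfl; exact hv'.symm
  generalize z i k = ik at *
  generalize z j k = jk at *
  generalize z k i = ki at *
  generalize z k j = kj at *
  clear hv'
  unfold EdgeUse at h
  rcases h with ⟨rfl, rfl, rfl, rfl⟩ | ⟨rfl, rfl, rfl, rfl⟩ | ⟨rfl, rfl, rfl, rfl⟩ |
    ⟨rfl, rfl, rfl, rfl⟩ | ⟨rfl, rfl, rfl, rfl⟩ | ⟨rfl, rfl, rfl, rfl⟩ | ⟨rfl, rfl, rfl, rfl⟩ |
    ⟨rfl, rfl, rfl, rfl⟩ | ⟨rfl, rfl, rfl, rfl⟩ | ⟨rfl, rfl, rfl, rfl⟩ | ⟨rfl, rfl, rfl, rfl⟩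
  · left; exact ⟨by omega, by rw [key 0 (by omega)]; push_cast; ring, by simp⟩
  · rcases (show d = 1 ∨ d = -1 by omega) with h | h
    · right; left; exact ⟨h, by rw [key 1 h]; push_cast; ring, by simp⟩
    · iterate 2 right
      left; exact ⟨h, by rw [key (-1) h]; push_cast; ring, by simp⟩
  · rcases (show d = 1 ∨ d = -1 by omega) with h | h
    · iterate 3 right
      left; exact ⟨h, by rw [key 1 h]; push_cast; ring, by simp⟩
    · iterate 4 right
      left; exact ⟨h, by rw [key (-1) h]; push_cast; ring, by simp⟩
  · iterate 5 right
    left; exact ⟨by omega, by rw [key 0 (by omega)]; push_cast; ring, by simp⟩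
  · iterate 6 right
    left; exact ⟨by omega, by rw [key 0 (by omega)]; push_cast; ring, by simp⟩
  · iterate 7 right
    left; exact ⟨by omega, by rw [key 1 (by omega)]; push_cast; ring, by simp⟩
  · iterate 8 right
    left; exact ⟨by omega, by rw [key 1 (by omega)]; push_cast; ring, by simp⟩
  · iterate 9 right
    left; exact ⟨by omega, by rw [key 0 (by omega)]; push_cast; ring, by simp⟩
  · iterate 10 right
    left; exact ⟨by omega, by rw [key 0 (by omega)]; push_cast; ring, by simp⟩
  · iterate 11 right
    left; exact ⟨by omega, by rw [key (-1) (by omega)]; push_cast; ring, by simp⟩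
  · iterate 12 right
    exact ⟨by omega, by rw [key (-1) (by omega)]; push_cast; ring, by simp⟩

/-- For odd length the divergence at i is ambiguous only if no edge at k is used. -/
theorem Setup.oneTwoCycle_odd_cases (hmod : n % 2 = 1)
    (S : Setup n m O i j k p (u₁ + p) (-p) u₂ (v₁ - p) v₂) (h₁₁ : 0 < u₁ + v₁) (h₂₂ : 0 < u₂ + v₂)
    (h₁₂ : 0 < u₁ + v₂) (h₂₁ : 0 < u₂ + v₁) {z : Fin 3 → Fin 3 → ℤ} (hz : O z) :
    ((m = p ∨ m = -p) ∧ z i k = 0 ∧ z j k = 0 ∧ z k i = 0 ∧ z k j = 0) ∨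
    (m = u₁ + v₂ ∧ z i k = 1 ∧ z j k = 0 ∧ z k i = 0 ∧ z k j = 1) ∨
    (m = u₂ + v₁ ∧ z i k = 0 ∧ z j k = 1 ∧ z k i = 1 ∧ z k j = 0) ∨
    (m = u₁ + p ∧ z i k = 1 ∧ z j k = 0 ∧ z k i = 0 ∧ z k j = 0) ∨
    (m = 2 * u₂ + v₁ + p ∧ z i k = 0 ∧ z j k = 2 ∧ z k i = 1 ∧ z k j = 0) ∨
    (m = u₂ ∧ z i k = 0 ∧ z j k = 1 ∧ z k i = 0 ∧ z k j = 0) ∨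
    (m = 2 * u₁ + v₂ ∧ z i k = 2 ∧ z j k = 0 ∧ z k i = 0 ∧ z k j = 1) ∨
    (m = v₁ - p ∧ z i k = 0 ∧ z j k = 0 ∧ z k i = 1 ∧ z k j = 0) ∨
    (m = u₁ + 2 * v₂ - p ∧ z i k = 1 ∧ z j k = 0 ∧ z k i = 0 ∧ z k j = 2) ∨
    (m = v₂ ∧ z i k = 0 ∧ z j k = 0 ∧ z k i = 0 ∧ z k j = 1) ∨
    (m = u₂ + 2 * v₁ ∧ z i k = 0 ∧ z j k = 1 ∧ z k i = 2 ∧ z k j = 0) := by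
  obtain ⟨h, hv⟩ := S.oneTwoCycle_opt h₁₁ h₂₂ h₁₂ h₂₁ hz
  have hf := (S.opt z hz).1
  have hv' : p * (z i j + z i k - z j i - z k i : ℤ) + u₁ * z i k + u₂ * z j k + v₁ * z k i +
    v₂ * z k j = m := by push_cast; exact hv
  have hd : -1 ≤ z i j + z i k - z j i - z k i ∧ z i j + z i k - z j i - z k i ≤ 1 ∧
    (n - (z i j + z i k - z j i - z k i) - z j k - z k j) % 2 = 0 ∧
    -1 ≤ (z i j + z i k - z j i - z k i) + (z k i + z k j - z i k - z j k) ∧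
    (z i j + z i k - z j i - z k i) + (z k i + z k j - z i k - z j k) ≤ 1 := by
    unfold FlowT at hf; omega
  clear hv hf
  generalize z i j + z i k - z j i - z k i = d at *
  have key : ∀ e : ℤ, d = e → m = p * e + u₁ * z i k + u₂ * z j k + v₁ * z k i + v₂ * z k j := by
    rintro e rfl; exact hv'.symm
  generalize z i k = ik at *
  generalize z j k = jk at *
  generalize z k i = ki at *
  generalize z k j = kj at *
  clear hv'
  unfold EdgeUse at h
  rcases h with ⟨rfl, rfl, rfl, rfl⟩ | ⟨rfl, rfl, rfl, rfl⟩ | ⟨rfl, rfl, rfl, rfl⟩ |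
    ⟨rfl, rfl, rfl, rfl⟩ | ⟨rfl, rfl, rfl, rfl⟩ | ⟨rfl, rfl, rfl, rfl⟩ | ⟨rfl, rfl, rfl, rfl⟩ |
    ⟨rfl, rfl, rfl, rfl⟩ | ⟨rfl, rfl, rfl, rfl⟩ | ⟨rfl, rfl, rfl, rfl⟩ | ⟨rfl, rfl, rfl, rfl⟩
  · left
    refine ⟨?_, by simp⟩
    rcases (show d = 1 ∨ d = -1 by omega) with h | h
    · left; rw [key 1 h]; push_cast; ring
    · right; rw [key (-1) h]; push_cast; ring
  · right; left; exact ⟨by rw [key 0 (by omega)]; push_cast; ring, by simp⟩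
  · iterate 2 right
    left; exact ⟨by rw [key 0 (by omega)]; push_cast; ring, by simp⟩
  · iterate 3 right
    left; exact ⟨by rw [key 1 (by omega)]; push_cast; ring, by simp⟩
  · iterate 4 right
    left; exact ⟨by rw [key 1 (by omega)]; push_cast; ring, by simp⟩
  · iterate 5 right
    left; exact ⟨by rw [key 0 (by omega)]; push_cast; ring, by simp⟩
  · iterate 6 right
    left; exact ⟨by rw [key 0 (by omega)]; push_cast; ring, by simp⟩
  · iterate 7 right
    left; exact ⟨by rw [key (-1) (by omega)]; push_cast; ring, by simp⟩
  · iterate 8 right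
    left; exact ⟨by rw [key (-1) (by omega)]; push_cast; ring, by simp⟩
  · iterate 9 right
    left; exact ⟨by rw [key 0 (by omega)]; push_cast; ring, by simp⟩
  · iterate 10 right
    exact ⟨by rw [key 0 (by omega)]; push_cast; ring, by simp⟩

/-- Either `O` is covered or every edge at `k` is used by some member of `O`. -/
theorem Setup.covered_or_used (S : Setup n m O i j k wij wik wji wjk wki wkj) :
    Covered n O ∨ (∃ z, O z ∧ z i k ≠ 0) ∧ (∃ z, O z ∧ z j k ≠ 0) ∧ (∃ z, O z ∧ z k i ≠ 0) ∧
      ∃ z, O z ∧ z k j ≠ 0 := by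
  by_contra! hc
  obtain ⟨hc, h⟩ := hc
  have h1 : ∃ z, O z ∧ z i k ≠ 0 := by
    by_contra! h
    exact hc ⟨i, k, j, S.hik, S.hij, S.hjk.symm, Or.inl h⟩
  have h2 : ∃ z, O z ∧ z j k ≠ 0 := by
    by_contra! h
    exact hc ⟨j, k, i, S.hjk, S.hij.symm, S.hik.symm, Or.inl h⟩
  have h3 : ∃ z, O z ∧ z k i ≠ 0 := by
    by_contra! h
    exact hc ⟨k, i, j, S.hik.symm, S.hjk.symm, S.hij, Or.inl h⟩
  exact hc ⟨k, j, i, S.hjk.symm, S.hik.symm, S.hij.symm, Or.inl (h h1 h2 h3)⟩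

/-- If `O` lies on no edge hyperplane, each of the four edges at k is used by an optimal flow, which
gives four equations for m. They are incompatible with the attained bounds on m and the positivity
of the cycle weights. -/
theorem Setup.covered_oneTwoCycle_odd (hn : 4 ≤ n) (hmod : n % 2 = 1)
    (S : Setup n m O i j k p (u₁ + p) (-p) u₂ (v₁ - p) v₂) (h₁₁ : 0 < u₁ + v₁) (h₂₂ : 0 < u₂ + v₂)
    (h₁₂ : 0 < u₁ + v₂) (h₂₁ : 0 < u₂ + v₁) : Covered n O := by
  rcases S.covered_or_used with h | ⟨⟨z1, hz1, h1⟩, ⟨z2, hz2, h2⟩, ⟨z3, hz3, h3⟩, ⟨z4, hz4, h4⟩⟩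
  · exact h
  exfalso
  have L := S.oneTwoCycle_lower
  have l1 := L 1 0 0 0 0
    (by omega) (by omega) (by omega) (by omega) (by omega) (by omega) (by omega)
  have l2 := L (-1) 0 0 0 0
    (by omega) (by omega) (by omega) (by omega) (by omega) (by omega) (by omega)
  have l3 := L 0 0 1 0 0
    (by omega) (by omega) (by omega) (by omega) (by omega) (by omega) (by omega)
  have l4 := L 0 2 0 0 1
    (by omega) (by omega) (by omega) (by omega) (by omega) (by omega) (by omega)
  have l5 := L 1 1 0 0 0
    (by omega) (by omega) (by omega) (by omega) (by omega) (by omega) (by omega)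
  have l6 := L 1 0 2 1 0
    (by omega) (by omega) (by omega) (by omega) (by omega) (by omega) (by omega)
  have l7 := L 0 0 0 0 1
    (by omega) (by omega) (by omega) (by omega) (by omega) (by omega) (by omega)
  have l8 := L 0 0 1 2 0
    (by omega) (by omega) (by omega) (by omega) (by omega) (by omega) (by omega)
  have l9 := L (-1) 0 0 1 0
    (by omega) (by omega) (by omega) (by omega) (by omega) (by omega) (by omega)
  have l10 := L (-1) 1 0 0 2
    (by omega) (by omega) (by omega) (by omega) (by omega) (by omega) (by omega)
  have l11 := L 0 1 0 0 1
    (by omega) (by omega) (by omega) (by omega) (by omega) (by omega) (by omega)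
  have l12 := L 0 0 1 1 0
    (by omega) (by omega) (by omega) (by omega) (by omega) (by omega) (by omega)
  push_cast at l1 l2 l3 l4 l5 l6 l7 l8 l9 l10 l11 l12
  have V := fun z hz => S.oneTwoCycle_odd_cases (z := z) hmod h₁₁ h₂₂ h₁₂ h₂₁ hz
  have w1 : m = 2 * u₁ + v₂ ∨ m = u₁ + p ∨ m = u₁ + 2 * v₂ - p := by
    rcases V z1 hz1 with h | h | h | h | h | h | h | h | h | h | h
    any_goals omega
    · exfalso; linarith
    · right; left; exact h.1
    · left; exact h.1
    · right; right; exact h.1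
  have w2 : m = u₂ ∨ m = 2 * u₂ + v₁ + p ∨ m = u₂ + 2 * v₁ := by
    rcases V z2 hz2 with h | h | h | h | h | h | h | h | h | h | h
    any_goals omega
    · exfalso; linarith
    · right; left; exact h.1
    · left; exact h.1
    · right; right; exact h.1
  have w3 : m = v₁ - p ∨ m = 2 * u₂ + v₁ + p ∨ m = u₂ + 2 * v₁ := by
    rcases V z3 hz3 with h | h | h | h | h | h | h | h | h | h | h
    any_goals omega
    · exfalso; linarith
    · right; left; exact h.1
    · left; exact h.1
    · right; right; exact h.1
  have w4 : m = v₂ ∨ m = 2 * u₁ + v₂ ∨ m = u₁ + 2 * v₂ - p := by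
    rcases V z4 hz4 with h | h | h | h | h | h | h | h | h | h | h
    any_goals omega
    · exfalso; linarith
    · right; left; exact h.1
    · right; right; exact h.1
    · left; exact h.1
  rcases w1 with w1 | w1 | w1 <;> rcases w2 with w2 | w2 | w2 <;> try linarith
  all_goals
    rcases w3 with w3 | w3 | w3 <;> try linarith
  all_goals
    rcases w4 with w4 | w4 | w4 <;> linarith

end OneTwoCycle
end Core

section Core

variable {n : ℤ} {m : ℝ} {O : (Fin 3 → Fin 3 → ℤ) → Prop} {i j k : Fin 3}
  {wij wik wji wjk wki wkj : ℝ}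

section OneTwoCycle

variable {p u₁ u₂ v₁ v₂ : ℝ}

theorem Setup.oneTwoCycle_even_bounds (hn : 4 ≤ n) (hmod : n % 2 = 0)
    (S : Setup n m O i j k p (u₁ + p) (-p) u₂ (v₁ - p) v₂) :
    m ≤ 0 ∧ m ≤ u₁ + v₂ + p ∧ m ≤ u₁ + v₂ - p ∧ m ≤ u₂ + v₁ + p ∧ m ≤ u₂ + v₁ - p ∧ m ≤ u₁ ∧
      m ≤ 2 * u₂ + v₁ ∧ m ≤ u₂ + p ∧ m ≤ 2 * u₁ + v₂ + p ∧ m ≤ v₁ ∧ m ≤ u₁ + 2 * v₂ ∧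
      m ≤ v₂ - p ∧ m ≤ u₂ + 2 * v₁ - p := by
  have L := S.oneTwoCycle_lower
  have l0 := L 0 0 0 0 0
    (by omega) (by omega) (by omega) (by omega) (by omega) (by omega) (by omega)
  have l1 := L 1 1 0 0 1
    (by omega) (by omega) (by omega) (by omega) (by omega) (by omega) (by omega)
  have l2 := L (-1) 1 0 0 1
    (by omega) (by omega) (by omega) (by omega) (by omega) (by omega) (by omega)
  have l3 := L 1 0 1 1 0
    (by omega) (by omega) (by omega) (by omega) (by omega) (by omega) (by omega)
  have l4 := L (-1) 0 1 1 0
    (by omega) (by omega) (by omega) (by omega) (by omega) (by omega) (by omega)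
  have l5 := L 0 1 0 0 0
    (by omega) (by omega) (by omega) (by omega) (by omega) (by omega) (by omega)
  have l6 := L 0 0 2 1 0
    (by omega) (by omega) (by omega) (by omega) (by omega) (by omega) (by omega)
  have l7 := L 1 0 1 0 0
    (by omega) (by omega) (by omega) (by omega) (by omega) (by omega) (by omega)
  have l8 := L 1 2 0 0 1
    (by omega) (by omega) (by omega) (by omega) (by omega) (by omega) (by omega)
  have l9 := L 0 0 0 1 0
    (by omega) (by omega) (by omega) (by omega) (by omega) (by omega) (by omega)
  have l10 := L 0 1 0 0 2
    (by omega) (by omega) (by omega) (by omega) (by omega) (by omega) (by omega)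
  have l11 := L (-1) 0 0 0 1
    (by omega) (by omega) (by omega) (by omega) (by omega) (by omega) (by omega)
  have l12 := L (-1) 0 1 2 0
    (by omega) (by omega) (by omega) (by omega) (by omega) (by omega) (by omega)
  push_cast at l0 l1 l2 l3 l4 l5 l6 l7 l8 l9 l10 l11 l12
  refine ⟨?_, ?_, ?_, ?_, ?_, ?_, ?_, ?_, ?_, ?_, ?_, ?_, ?_⟩ <;> linarith

theorem Setup.covered_oneTwoCycle_even_aux (hn : 4 ≤ n) (hmod : n % 2 = 0)
    (S : Setup n m O i j k p (u₁ + p) (-p) u₂ (v₁ - p) v₂) (h₁₁ : 0 < u₁ + v₁) (h₂₂ : 0 < u₂ + v₂)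
    (h₁₂ : 0 < u₁ + v₂) (h₂₁ : 0 < u₂ + v₁) (hm : m = u₁ + v₂ - p) (hm' : m = u₂ + v₁ - p) :
    Covered n O := by
  obtain ⟨l0, l1, l2, l3, l4, l5, l6, l7, l8, l9, l10, l11, l12⟩ :=
    S.oneTwoCycle_even_bounds hn hmod
  refine ⟨i, j, k, S.hij, S.hik, S.hjk, ?_⟩
  iterate 4 right
  left
  refine ⟨hmod, fun z hz => ?_⟩
  obtain ⟨d, hd, h⟩ := S.oneTwoCycle_even_cases hmod h₁₁ h₂₂ h₁₂ h₂₁ hz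
  have hf := (S.opt z hz).1
  unfold FlowT at hf
  rcases h with h | h | h | h | h | h | h | h | h | h | h | h | h
  · omega
  · exfalso; linarith
  · omega
  · exfalso; linarith
  · omega
  · omega
  · exfalso; linarith
  · exfalso; linarith
  · exfalso; linarith
  · exfalso; linarith
  · exfalso; linarith
  · omega
  · exfalso; linarith

/-- As for odd n, but here a pattern survives: both 3-cycles are optimal with the same sink, which
is i or j. That state then receives half of all transitions in every optimal flow. Exchanging i and
j reduces one choice of sink to the other. -/
theorem Setup.covered_oneTwoCycle_even (hn : 4 ≤ n) (hmod : n % 2 = 0)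
    (S : Setup n m O i j k p (u₁ + p) (-p) u₂ (v₁ - p) v₂) (h₁₁ : 0 < u₁ + v₁) (h₂₂ : 0 < u₂ + v₂)
    (h₁₂ : 0 < u₁ + v₂) (h₂₁ : 0 < u₂ + v₁) : Covered n O := by
  rcases S.covered_or_used with h | ⟨⟨z1, hz1, h1⟩, ⟨z2, hz2, h2⟩, ⟨z3, hz3, h3⟩, ⟨z4, hz4, h4⟩⟩
  · exact h
  obtain ⟨l0, l1, l2, l3, l4, l5, l6, l7, l8, l9, l10, l11, l12⟩ :=
    S.oneTwoCycle_even_bounds hn hmod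
  have V := fun z hz => S.oneTwoCycle_even_cases (z := z) hmod h₁₁ h₂₂ h₁₂ h₂₁ hz
  have w1 : m = u₁ + v₂ + p ∨ m = u₁ + v₂ - p ∨ m = u₁ ∨ m = 2 * u₁ + v₂ + p ∨
      m = u₁ + 2 * v₂ := by
    obtain ⟨d, -, h⟩ := V z1 hz1
    rcases h with h | h | h | h | h | h | h | h | h | h | h | h | h
    any_goals omega
    all_goals simp [h.2.1]
  have w2 : m = u₂ + v₁ + p ∨ m = u₂ + v₁ - p ∨ m = 2 * u₂ + v₁ ∨ m = u₂ + p ∨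
      m = u₂ + 2 * v₁ - p := by
    obtain ⟨d, -, h⟩ := V z2 hz2
    rcases h with h | h | h | h | h | h | h | h | h | h | h | h | h
    any_goals omega
    all_goals simp [h.2.1]
  have w3 : m = u₂ + v₁ + p ∨ m = u₂ + v₁ - p ∨ m = 2 * u₂ + v₁ ∨ m = v₁ ∨
      m = u₂ + 2 * v₁ - p := by
    obtain ⟨d, -, h⟩ := V z3 hz3
    rcases h with h | h | h | h | h | h | h | h | h | h | h | h | h
    any_goals omega
    all_goals simp [h.2.1]
  have w4 : m = u₁ + v₂ + p ∨ m = u₁ + v₂ - p ∨ m = 2 * u₁ + v₂ + p ∨ m = u₁ + 2 * v₂ ∨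
      m = v₂ - p := by
    obtain ⟨d, -, h⟩ := V z4 hz4
    rcases h with h | h | h | h | h | h | h | h | h | h | h | h | h
    any_goals omega
    all_goals simp [h.2.1]
  have key : (m = u₁ + v₂ - p ∧ m = u₂ + v₁ - p) ∨ (m = u₁ + v₂ + p ∧ m = u₂ + v₁ + p) := by
    rcases w1 with w1 | w1 | w1 | w1 | w1 <;> rcases w2 with w2 | w2 | w2 | w2 | w2 <;>
      try (exfalso; linarith)
    all_goals
      rcases w3 with w3 | w3 | w3 | w3 | w3 <;> try (exfalso; linarith)
    all_goals
      first
      | exact Or.inl ⟨by linarith, by linarith⟩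
      | exact Or.inr ⟨by linarith, by linarith⟩
      | skip
    all_goals
      rcases w4 with w4 | w4 | w4 | w4 | w4
    all_goals
      first
      | (exfalso; linarith)
      | exact Or.inl ⟨by linarith, by linarith⟩
  rcases key with h | h
  · exact S.covered_oneTwoCycle_even_aux hn hmod h₁₁ h₂₂ h₁₂ h₂₁ h.1 h.2
  -- The potential is renormalised to vanish at i and k of the old naming: it becomes -p at j, and
  -- the charges change by p accordingly.
  · refine Setup.covered_oneTwoCycle_even_aux (i := j) (j := i) (k := k) (m := m) (p := -p)
      (u₁ := u₂ + p) (u₂ := u₁ + p) (v₁ := v₂ - p) (v₂ := v₁ - p) hn hmod ?_ (by linarith)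
      (by linarith) (by linarith) (by linarith) (by linarith) (by linarith)
    apply S.swap.congr <;> ring

end OneTwoCycle

/-- The case of weight zero on just one cycle, a 2-cycle. -/
theorem Setup.covered_oneTwoCycle (hn : 4 ≤ n)
    (S : Setup n m O i j k wij wik wji wjk wki wkj) (h : wij + wji = 0) (h₁ : 0 < wik + wki)
    (h₂ : 0 < wjk + wkj) (ha : 0 < wik + wkj + wji) (hb : 0 < wij + wjk + wki) :
    Covered n O := by
  have S' : Setup n m O i j k wij ((wik - wij) + wij) (-wij) wjk ((wki + wij) - wij) wkj := by
    apply S.congr <;> linarith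
  rcases Int.emod_two_eq_zero_or_one n with hmod | hmod
  · exact S'.covered_oneTwoCycle_even hn hmod (by linarith) (by linarith) (by linarith)
      (by linarith)
  · exact S'.covered_oneTwoCycle_odd hn hmod (by linarith) (by linarith) (by linarith)
      (by linarith)

/-! ### Assembling the cases for an arbitrary weight -/

theorem Setup.swap_ne (hne : ∃ a b c d e f : ℤ, FlowT n a b c d e f ∧
      m < wij * a + wik * b + wji * c + wjk * d + wki * e + wkj * f) :
    ∃ a b c d e f : ℤ, FlowT n a b c d e f ∧
      m < wji * a + wjk * b + wij * c + wik * d + wkj * e + wki * f := by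
  obtain ⟨a, b, c, d, e, f, hf, hlt⟩ := hne
  exact ⟨c, d, a, b, f, e, by unfold FlowT at hf ⊢; omega, by linarith⟩

theorem Setup.covered_of_zero_twoCycle (hn : 4 ≤ n)
    (S : Setup n m O i j k wij wik wji wjk wki wkj) (h : wij + wji = 0) (h₁ : 0 ≤ wik + wki)
    (h₂ : 0 ≤ wjk + wkj) (ha : 0 < wik + wkj + wji) (hb : 0 < wij + wjk + wki) :
    Covered n O := by
  rcases h₂.lt_or_eq with h₂' | h₂'
  · rcases h₁.lt_or_eq with h₁' | h₁'
    · exact S.covered_oneTwoCycle hn h h₁' h₂' ha hb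
    · exact S.swap.covered_twoTwoCycles hn (by linarith) (by linarith) (by linarith)
        (by linarith)
  · exact S.covered_twoTwoCycles hn h (by linarith) ha hb

/-- The case in which the minimal mean weight of a cycle is zero. -/
theorem Setup.covered_of_nonneg (hn : 4 ≤ n)
    (S : Setup n m O i j k wij wik wji wjk wki wkj) (hA : 0 ≤ wij + wji) (hB : 0 ≤ wik + wki)
    (hC : 0 ≤ wjk + wkj) (hD : 0 ≤ wij + wjk + wki) (hE : 0 ≤ wik + wkj + wji)
    (hz : wij + wji = 0 ∨ wik + wki = 0 ∨ wjk + wkj = 0 ∨ wij + wjk + wki = 0 ∨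
      wik + wkj + wji = 0)
    (hne : ∃ a b c d e f : ℤ, FlowT n a b c d e f ∧
      m < wij * a + wik * b + wji * c + wjk * d + wki * e + wkj * f) :
    Covered n O := by
  -- The three 2-cycles together weigh as much as the two 3-cycles together, so positive 3-cycles
  -- leave at most two zero 2-cycles.
  rcases hE.lt_or_eq with hE' | hE'
  · rcases hD.lt_or_eq with hD' | hD'
    · rcases hz with h | h | h | h | h
      · exact S.covered_of_zero_twoCycle hn h hB hC hE' hD'
      · exact S.rotate.rotate.covered_of_zero_twoCycle hn (by linarith) (by linarith)
          (by linarith) (by linarith) (by linarith)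
      · exact S.rotate.covered_of_zero_twoCycle hn h (by linarith) (by linarith) (by linarith)
          (by linarith)
      · linarith
      · linarith
    · exact S.swap.covered_threeCycle hn (by linarith) (by linarith) (by linarith) (by linarith)
        (Setup.swap_ne hne)
  · exact S.covered_threeCycle hn hE'.symm hA hC (by linarith) hne

/-- The optimal flows of a nonconstant weight are covered. -/
theorem Setup.covered (hn : 4 ≤ n) (S : Setup n m O i j k wij wik wji wjk wki wkj)
    (hne : ∃ a b c d e f : ℤ, FlowT n a b c d e f ∧
      m < wij * a + wik * b + wji * c + wjk * d + wki * e + wkj * f) :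
    Covered n O := by
  -- Here l is the least mean weight of the five simple cycles. Every flow has n edges, so
  -- subtracting l from all weights shifts all costs by l n.
  obtain ⟨l, hA, hB, hC, hD, hE, hz⟩ : ∃ l : ℝ, 0 ≤ wij + wji - 2 * l ∧ 0 ≤ wik + wki - 2 * l ∧
      0 ≤ wjk + wkj - 2 * l ∧ 0 ≤ wij + wjk + wki - 3 * l ∧ 0 ≤ wik + wkj + wji - 3 * l ∧
      (wij + wji - 2 * l = 0 ∨ wik + wki - 2 * l = 0 ∨ wjk + wkj - 2 * l = 0 ∨
      wij + wjk + wki - 3 * l = 0 ∨ wik + wkj + wji - 3 * l = 0) := by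
    obtain ⟨l, hl, hmin⟩ := Finset.exists_min_image
      {(wij + wji) / 2, (wik + wki) / 2, (wjk + wkj) / 2, (wij + wjk + wki) / 3,
        (wik + wkj + wji) / 3} id ⟨(wij + wji) / 2, by simp⟩
    simp only [Finset.mem_insert, Finset.mem_singleton, id, forall_eq_or_imp, forall_eq] at hl hmin
    refine ⟨l, ?_, ?_, ?_, ?_, ?_, ?_⟩
    iterate 5 linarith
    rcases hl with h | h | h | h | h
    · left; linarith
    · right; left; linarith
    · right; right; left; linarith
    · right; right; right; left; linarith
    · right; right; right; right; linarith
  have hsum : ∀ {a b c d e f : ℤ}, FlowT n a b c d e f → (a + b + c + d + e + f : ℝ) = n := by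
    intro a b c d e f h
    have := h.2.1
    exact_mod_cast this
  have S' : Setup n (m - l * n) O i j k (wij - l) (wik - l) (wji - l) (wjk - l) (wki - l)
      (wkj - l) :=
    { hij := S.hij
      hik := S.hik
      hjk := S.hjk
      lower := fun a b c d e f h => by
        have h1 := S.lower a b c d e f h
        rw [← hsum h]
        linarith
      opt := fun z hz => by
        obtain ⟨h, h1⟩ := S.opt z hz
        refine ⟨h, ?_⟩
        rw [← hsum h, ← h1]
        ring }
  refine S'.covered_of_nonneg hn (by linarith) (by linarith) (by linarith) (by linarith)
    (by linarith) ?_ ?_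
  · rcases hz with h | h | h | h | h
    · left; linarith
    · right; left; linarith
    · right; right; left; linarith
    · right; right; right; left; linarith
    · right; right; right; right; linarith
  · obtain ⟨a, b, c, d, e, f, hf, hlt⟩ := hne
    refine ⟨a, b, c, d, e, f, hf, ?_⟩
    rw [← hsum hf]
    linarith

end Core

/-! ### Words and flows: Eulerian trails on three states -/

/-- The number of transitions `i → j` of a word, as an integer. -/
def countZ {n : ℕ} (w : Fin (n + 1) → Fin 3) (i j : Fin 3) : ℤ :=
  ∑ t : Fin n, if w t.castSucc = i ∧ w t.succ = j then 1 else 0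

theorem transitionCount_eq_countZ {n : ℕ} (w : Word (n + 1)) (p : Transition) :
    (transitionCount w p : ℤ) = countZ w.1 p.1.1 p.1.2 := by
  unfold transitionCount countZ
  rw [Finset.card_filter, Fin.sum_univ_castSucc]
  push_cast
  have h : ¬ ∃ h : n + 1 < n + 1, w.1 (Fin.last n) = p.1.1 ∧ w.1 ⟨n + 1, h⟩ = p.1.2 := by
    rintro ⟨h, -⟩
    omega
  rw [if_neg h, add_zero]
  refine Finset.sum_congr rfl fun t _ => ?_
  congr 1
  refine propext ⟨fun ⟨_, h⟩ => h, fun h => ⟨?_, h⟩⟩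
  simp

theorem Word.ne_succ {n : ℕ} (w : Word (n + 1)) (t : Fin n) : w.1 t.castSucc ≠ w.1 t.succ :=
  w.2 t.castSucc (by simp)

theorem sum_castSucc_sub_succ {n : ℕ} (f : Fin (n + 1) → ℤ) :
    ∑ t : Fin n, (f t.castSucc - f t.succ) = f 0 - f (Fin.last n) := by
  have h₁ := Fin.sum_univ_castSucc f
  have h₂ := Fin.sum_univ_succ f
  rw [Finset.sum_sub_distrib]
  linarith

/-- A flow of length `n`. -/
def IsFlow (n : ℤ) (z : Fin 3 → Fin 3 → ℤ) : Prop :=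
  FlowT n (z 0 1) (z 0 2) (z 1 0) (z 1 2) (z 2 0) (z 2 1)

/-- The divergence at i telescopes to the indicator of starting at i minus the indicator of ending
at i. -/
theorem isFlow_countZ {n : ℕ} (w : Word (n + 1)) : IsFlow n (countZ w.1) := by
  have hnn : ∀ i j, 0 ≤ countZ w.1 i j := fun i j =>
    Finset.sum_nonneg fun t _ => by split_ifs <;> simp
  have hsum : countZ w.1 0 1 + countZ w.1 0 2 + countZ w.1 1 0 + countZ w.1 1 2 + countZ w.1 2 0 +
      countZ w.1 2 1 = n := by
    unfold countZ
    simp only [← Finset.sum_add_distrib]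
    rw [Finset.sum_congr rfl (g := fun _ => (1 : ℤ))]
    · simp
    · intro t _
      have := w.ne_succ t
      generalize w.1 t.castSucc = a at *
      generalize w.1 t.succ = b at *
      revert a b; decide
  have hdiv : ∀ i j k : Fin 3, i ≠ j → i ≠ k → j ≠ k →
      -1 ≤ countZ w.1 i j + countZ w.1 i k - countZ w.1 j i - countZ w.1 k i ∧
      countZ w.1 i j + countZ w.1 i k - countZ w.1 j i - countZ w.1 k i ≤ 1 := by
    intro i j k hij hik hjk
    have : countZ w.1 i j + countZ w.1 i k - countZ w.1 j i - countZ w.1 k i =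
        (if w.1 0 = i then 1 else 0) - (if w.1 (Fin.last n) = i then 1 else 0) := by
      rw [← sum_castSucc_sub_succ fun t => if w.1 t = i then (1 : ℤ) else 0]
      unfold countZ
      simp only [← Finset.sum_add_distrib, ← Finset.sum_sub_distrib]
      refine Finset.sum_congr rfl fun t _ => ?_
      have := w.ne_succ t
      generalize w.1 t.castSucc = a at *
      generalize w.1 t.succ = b at *
      revert i j k a b; decide
    rw [this]
    split_ifs <;> simp
  have h0 := hdiv 0 1 2 (by decide) (by decide) (by decide)
  have h1 := hdiv 1 0 2 (by decide) (by decide) (by decide)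
  have h2 := hdiv 2 0 1 (by decide) (by decide) (by decide)
  have := hnn 0 1
  have := hnn 0 2
  have := hnn 1 0
  have := hnn 1 2
  have := hnn 2 0
  have := hnn 2 1
  unfold IsFlow FlowT
  omega

/-- `z` counts the transitions of a word of `n + 1` letters that ends in `t`. -/
def Reached (n : ℕ) (z : Fin 3 → Fin 3 → ℤ) (t : Fin 3) : Prop :=
  ∃ w : Word (n + 1), w.1 (Fin.last n) = t ∧ ∀ i j, i ≠ j → countZ w.1 i j = z i j

theorem Reached.snoc {n : ℕ} {z z' : Fin 3 → Fin 3 → ℤ} {t u : Fin 3} (h : Reached n z t)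
    (htu : t ≠ u) (hz : ∀ i j, i ≠ j → z' i j = z i j + if t = i ∧ u = j then 1 else 0) :
    Reached (n + 1) z' u := by
  obtain ⟨w, hw, hc⟩ := h
  have e1 : ∀ s : Fin (n + 1), Fin.snoc (α := fun _ => Fin 3) w.1 u s.castSucc = w.1 s :=
    fun s => Fin.snoc_castSucc (α := fun _ => Fin 3) u w.1 s
  have e2 : Fin.snoc (α := fun _ => Fin 3) w.1 u (Fin.last (n + 1)) = u :=
    Fin.snoc_last (α := fun _ => Fin 3) u w.1
  have e3 : ∀ s : Fin n, Fin.snoc (α := fun _ => Fin 3) w.1 u s.castSucc.succ = w.1 s.succ :=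
    fun s => by rw [Fin.succ_castSucc]; exact e1 _
  have e4 : Fin.snoc (α := fun _ => Fin 3) w.1 u (Fin.last n).succ = u := by
    rw [Fin.succ_last]; exact e2
  have key : ∀ s : Fin (n + 1), Fin.snoc (α := fun _ => Fin 3) w.1 u s.castSucc ≠
      Fin.snoc (α := fun _ => Fin 3) w.1 u s.succ := by
    intro s
    rw [e1]
    refine Fin.lastCases ?_ (fun s => ?_) s
    · rw [e4, hw]; exact htu
    · rw [e3]; exact w.ne_succ s
  refine ⟨⟨Fin.snoc (α := fun _ => Fin 3) w.1 u, fun i h => ?_⟩, e2, fun i j hij => ?_⟩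
  · exact key ⟨i, by omega⟩
  · rw [hz i j hij, ← hc i j hij]
    unfold countZ
    rw [Fin.sum_univ_castSucc]
    simp only [e1, e3, e4, hw]

/-- This finds the last transition p → t of a trail from s to t such that, after its removal, the
induction hypothesis still applies with end p. The delicate case is p = s, where the rest is a
closed trail and must still enter s. -/
theorem exists_pred {n : ℕ} {z : Fin 3 → Fin 3 → ℤ} {s t : Fin 3}
    (h0 : ∀ i j, i ≠ j → 0 ≤ z i j)
    (hs : z 0 1 + z 0 2 + z 1 0 + z 1 2 + z 2 0 + z 2 1 = (n + 1 : ℕ))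
    (hd : ∀ i j k, i ≠ j → i ≠ k → j ≠ k → z i j + z i k - z j i - z k i =
      (if s = i then 1 else 0) - (if t = i then 1 else 0))
    (hst : s = t → 0 < n + 1 → ∃ j, j ≠ t ∧ z j t ≠ 0) :
    ∃ p, p ≠ t ∧ 1 ≤ z p t ∧ (s = p → 0 < n → ∃ j, j ≠ p ∧ z j p ≠ 0) := by
  by_cases h : s = t
  · obtain ⟨j, hj, hz⟩ := hst h (by omega)
    have := h0 j t hj
    exact ⟨j, hj, by omega, fun h' => absurd (h'.symm.trans h) hj⟩
  · obtain ⟨v, hvs, hvt⟩ : ∃ v, v ≠ s ∧ v ≠ t := by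
      clear * -
      revert s t; decide
    have e1 := hd t s v (Ne.symm h) hvt.symm hvs.symm
    have e2 := hd s t v h hvs.symm hvt.symm
    rw [if_neg h, if_pos rfl] at e1
    rw [if_pos rfl, if_neg (Ne.symm h)] at e2
    have := h0 t s (Ne.symm h)
    have := h0 t v hvt.symm
    have := h0 s t h
    have := h0 s v hvs.symm
    have := h0 v s hvs
    have := h0 v t hvt
    by_cases hv : 1 ≤ z v t
    · exact ⟨v, hvt, hv, fun h' => absurd h'.symm hvs⟩
    -- All inflow of t now comes from s. If s had no inflow, its outflow would be 1, and s → t would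
    -- be the only transition, contradicting 0 < n.
    · refine ⟨s, h, by omega, fun _ hn => ?_⟩
      by_contra! hc
      have c1 := hc t (Ne.symm h)
      have c2 := hc v hvs
      have hall : z s t + z s v + z t s + z t v + z v s + z v t = (n + 1 : ℕ) := by
        rw [← hs]
        clear * - h hvs hvt
        revert h hvs hvt
        fin_cases s <;> fin_cases t <;> fin_cases v <;> simp <;> ring
      omega

/-- Any two cycles on three states share a state, so a circulation has connected support.
Connectivity therefore only demands that a nonempty closed trail pass through its endpoint, which is
the last hypothesis. -/
theorem reached_of_eulerian {n : ℕ} : ∀ (z : Fin 3 → Fin 3 → ℤ) (s t : Fin 3),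
    (∀ i j, i ≠ j → 0 ≤ z i j) → z 0 1 + z 0 2 + z 1 0 + z 1 2 + z 2 0 + z 2 1 = n →
    (∀ i j k, i ≠ j → i ≠ k → j ≠ k → z i j + z i k - z j i - z k i =
      (if s = i then 1 else 0) - (if t = i then 1 else 0)) →
    (s = t → 0 < n → ∃ j, j ≠ t ∧ z j t ≠ 0) → Reached n z t := by
  induction n with
  | zero =>
    intro z s t h0 hs _ _
    refine ⟨⟨fun _ => t, fun i h => by omega⟩, rfl, fun i j hij => ?_⟩
    have := h0 0 1 (by decide)
    have := h0 0 2 (by decide)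
    have := h0 1 0 (by decide)
    have := h0 1 2 (by decide)
    have := h0 2 0 (by decide)
    have := h0 2 1 (by decide)
    have : ∀ i j : Fin 3, i ≠ j → z i j = 0 := by
      intro i j hij
      fin_cases i <;> fin_cases j <;> simp at hij ⊢ <;> omega
    simp [countZ, this i j hij]
  | succ n ih =>
    intro z s t h0 hs hd hst
    obtain ⟨p, hpt, hp, hp'⟩ := exists_pred h0 hs hd hst
    refine Reached.snoc (t := p) (z := fun i j => z i j - if p = i ∧ t = j then 1 else 0)
      (ih _ s p ?_ ?_ ?_ ?_) hpt fun i j _ => by ring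
    · intro i j hij
      have := h0 i j hij
      split_ifs with h
      · obtain ⟨rfl, rfl⟩ := h; omega
      · omega
    · have : (if p = 0 ∧ t = 1 then (1 : ℤ) else 0) + (if p = 0 ∧ t = 2 then 1 else 0) +
          (if p = 1 ∧ t = 0 then 1 else 0) + (if p = 1 ∧ t = 2 then 1 else 0) +
          (if p = 2 ∧ t = 0 then 1 else 0) + (if p = 2 ∧ t = 1 then 1 else 0) = 1 := by
        clear * - hpt
        revert p t; decide
      push_cast at hs
      linarith
    · intro i j k hij hik hjk
      have h := hd i j k hij hik hjk
      have : (if p = i ∧ t = j then (1 : ℤ) else 0) + (if p = i ∧ t = k then 1 else 0) -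
          (if p = j ∧ t = i then 1 else 0) - (if p = k ∧ t = i then 1 else 0) =
          (if p = i then 1 else 0) - (if t = i then 1 else 0) := by
        clear * - hpt hij hik hjk
        revert p t i j k; decide
      linarith
    · intro h hn
      obtain ⟨j, hj, hz⟩ := hp' h hn
      refine ⟨j, hj, ?_⟩
      rw [if_neg fun h => hj h.1.symm]
      simpa using hz

theorem exists_word_of_isFlow {n : ℕ} (hn : 0 < n) {z : Fin 3 → Fin 3 → ℤ} (hz : IsFlow n z) :
    ∃ w : Word (n + 1), ∀ i j, i ≠ j → countZ w.1 i j = z i j := by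
  suffices ∃ s t : Fin 3, (z 0 1 + z 0 2 - z 1 0 - z 2 0 =
      (if s = 0 then 1 else 0) - (if t = 0 then 1 else 0)) ∧ (z 1 0 + z 1 2 - z 0 1 - z 2 1 =
      (if s = 1 then 1 else 0) - (if t = 1 then 1 else 0)) ∧
      (s = t → ∃ j, j ≠ t ∧ z j t ≠ 0) by
    obtain ⟨s, t, h1, h2, h3⟩ := this
    have h4 : z 2 0 + z 2 1 - z 0 2 - z 1 2 =
      (if s = 2 then 1 else 0) - (if t = 2 then 1 else 0) := by
      have e1 : (if s = 0 then (1 : ℤ) else 0) + (if s = 1 then 1 else 0) +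
        (if s = 2 then 1 else 0) = 1 := by clear * -; revert s; decide
      have e2 : (if t = 0 then (1 : ℤ) else 0) + (if t = 1 then 1 else 0) +
        (if t = 2 then 1 else 0) = 1 := by clear * -; revert t; decide
      linarith
    unfold IsFlow FlowT at hz
    obtain ⟨w, -, hw⟩ := reached_of_eulerian (n := n) z s t
      (by intro i j hij; fin_cases i <;> fin_cases j <;> simp at hij ⊢ <;> omega) hz.2.1
      (by
        intro i j k hij hik hjk
        fin_cases i <;> fin_cases j <;> fin_cases k <;> simp at hij hik hjk ⊢ <;> linarith)
      (fun h _ => h3 h)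
    exact ⟨w, hw⟩
  unfold IsFlow FlowT at hz
  rcases @hex_cases (z 0 1 + z 0 2 - z 1 0 - z 2 0) (z 1 0 + z 1 2 - z 0 1 - z 2 1) (by omega)
    (by omega) (by omega) with h | h | h | h | h | h | h
  -- For a circulation the endpoint must be a state that is visited. If nothing enters state 0,
  -- nothing leaves it either, so all transitions are between 1 and 2.
  · by_cases h0 : z 1 0 = 0 ∧ z 2 0 = 0
    · refine ⟨1, 1, by simpa using h.1, by simpa using h.2, fun _ => ⟨2, by decide, by omega⟩⟩
    · refine ⟨0, 0, by simpa using h.1, by simpa using h.2, fun _ => ?_⟩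
      by_cases h1 : z 1 0 = 0
      · exact ⟨2, by decide, by omega⟩
      · exact ⟨1, by decide, h1⟩
  · exact ⟨0, 1, by simpa using h.1, by simpa using h.2, fun h => absurd h (by decide)⟩
  · exact ⟨1, 0, by simpa using h.1, by simpa using h.2, fun h => absurd h (by decide)⟩
  · exact ⟨0, 2, by simpa using h.1, by simpa using h.2, fun h => absurd h (by decide)⟩
  · exact ⟨2, 0, by simpa using h.1, by simpa using h.2, fun h => absurd h (by decide)⟩
  · exact ⟨1, 2, by simpa using h.1, by simpa using h.2, fun h => absurd h (by decide)⟩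
  · exact ⟨2, 1, by simpa using h.1, by simpa using h.2, fun h => absurd h (by decide)⟩

/-! ### Linear algebra of faces and tight sets -/

/-- The linear functional `x ↦ c ⬝ᵥ x`. -/
def dotLin (c : Transition → ℝ) : (Transition → ℝ) →ₗ[ℝ] ℝ where
  toFun x := c ⬝ᵥ x
  map_add' := dotProduct_add c
  map_smul' r x := by simp

@[simp] theorem dotLin_apply (c x : Transition → ℝ) : dotLin c x = c ⬝ᵥ x := rfl

theorem sum_transition {M : Type*} [AddCommMonoid M] (f : Transition → M) :
    ∑ p, f p = f ⟨(0, 1), by decide⟩ + f ⟨(0, 2), by decide⟩ + f ⟨(1, 0), by decide⟩ +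
      f ⟨(1, 2), by decide⟩ + f ⟨(2, 0), by decide⟩ + f ⟨(2, 1), by decide⟩ := by
  have : (Finset.univ : Finset Transition) = {⟨(0, 1), by decide⟩, ⟨(0, 2), by decide⟩,
      ⟨(1, 0), by decide⟩, ⟨(1, 2), by decide⟩, ⟨(2, 0), by decide⟩, ⟨(2, 1), by decide⟩} := by
    decide
  rw [this]
  iterate 5 rw [Finset.sum_insert (by decide)]
  rw [Finset.sum_singleton]
  simp only [add_assoc]

theorem finrank_transition : Module.finrank ℝ (Transition → ℝ) = 6 := by
  rw [Module.finrank_fintype_fun_eq_card]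
  rfl

theorem vectorSpan_le_ker {S : Set (Transition → ℝ)} {c : Transition → ℝ} {r : ℝ}
    (h : ∀ x ∈ S, c ⬝ᵥ x = r) : vectorSpan ℝ S ≤ LinearMap.ker (dotLin c) := by
  rw [vectorSpan_def, Submodule.span_le]
  rintro _ ⟨x, hx, y, hy, rfl⟩
  simp only [vsub_eq_sub, SetLike.mem_coe, LinearMap.mem_ker, map_sub, dotLin_apply, h x hx, h y hy,
    sub_self]

theorem finrank_ker_one : Module.finrank ℝ (LinearMap.ker (dotLin 1)) = 5 := by
  have h : dotLin 1 ≠ 0 := by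
    intro h
    have := congrArg (fun f => f (Pi.single (⟨(0, 1), by decide⟩ : Transition) 1)) h
    simp only [dotLin_apply, dotProduct_single_one, Pi.one_apply, LinearMap.zero_apply,
      one_ne_zero] at this
  have := Module.Dual.finrank_ker_add_one_of_ne_zero (f := dotLin 1) h
  rw [finrank_transition] at this
  omega

theorem tightSet_subset (P : Set (Transition → ℝ)) (c : Transition → ℝ) : tightSet P c ⊆ P :=
  fun _ h => h.1

theorem dim_empty : dim ∅ = 0 := by
  rw [dim, vectorSpan_empty, finrank_bot]

/-- A tight set that contains five affinely independent points has dimension four. -/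
theorem dim_tightSet_of_independent {P : Set (Transition → ℝ)} {N : ℝ}
    (hN : ∀ x ∈ P, 1 ⬝ᵥ x = N) {c x₀ x₁ x₂ x₃ x₄ y : Transition → ℝ}
    (h₀ : x₀ ∈ tightSet P c) (h₁ : x₁ ∈ tightSet P c) (h₂ : x₂ ∈ tightSet P c)
    (h₃ : x₃ ∈ tightSet P c) (h₄ : x₄ ∈ tightSet P c)
    (hli : LinearIndependent ℝ ![x₁ - x₀, x₂ - x₀, x₃ - x₀, x₄ - x₀])
    (hy : y ∈ P) (hcy : c ⬝ᵥ y ≠ 0) : dim (tightSet P c) = 4 ∧ dim P = 5 := by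
  have hlow : 4 ≤ dim (tightSet P c) := by
    have hle : Submodule.span ℝ (Set.range ![x₁ - x₀, x₂ - x₀, x₃ - x₀, x₄ - x₀]) ≤
        vectorSpan ℝ (tightSet P c) := by
      rw [Submodule.span_le]
      rintro _ ⟨i, rfl⟩
      fin_cases i
      · exact vsub_mem_vectorSpan ℝ h₁ h₀
      · exact vsub_mem_vectorSpan ℝ h₂ h₀
      · exact vsub_mem_vectorSpan ℝ h₃ h₀
      · exact vsub_mem_vectorSpan ℝ h₄ h₀
    have := Submodule.finrank_mono hle
    rwa [finrank_span_eq_card hli, Fintype.card_fin] at this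
  -- The point y is off the hyperplane, so the polytope has larger dimension than its tight set; the
  -- constant coordinate sum bounds it by 5.
  have hlt : vectorSpan ℝ (tightSet P c) < vectorSpan ℝ P := by
    refine lt_of_le_of_ne (vectorSpan_mono ℝ (tightSet_subset P c)) fun h => hcy ?_
    have hmem : y - x₀ ∈ vectorSpan ℝ (tightSet P c) := by
      rw [h]
      exact vsub_mem_vectorSpan ℝ hy h₀.1
    have := vectorSpan_le_ker (fun x (hx : x ∈ tightSet P c) => hx.2) hmem
    rw [LinearMap.mem_ker, map_sub, dotLin_apply, dotLin_apply, h₀.2, sub_zero] at this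
    exact this
  have h1 := Submodule.finrank_lt_finrank_of_lt hlt
  have h2 := Submodule.finrank_mono (vectorSpan_le_ker hN)
  rw [finrank_ker_one] at h2
  unfold dim at hlow ⊢
  omega

/-- Functionals that are nonnegative on `P` and have the same tight set are proportional. -/
theorem exists_smul_of_tightSet_eq {P : Set (Transition → ℝ)} {N : ℝ} (hN0 : N ≠ 0)
    (hN : ∀ x ∈ P, 1 ⬝ᵥ x = N) {c c' : Transition → ℝ} (hc : ∀ x ∈ P, 0 ≤ c ⬝ᵥ x)
    (hc' : ∀ x ∈ P, 0 ≤ c' ⬝ᵥ x) (h : tightSet P c = tightSet P c')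
    (h4 : dim (tightSet P c) = 4) (h5 : dim P = 5) : ∃ a : ℝ, 0 < a ∧ c' = a • c := by
  obtain ⟨x₀, h₀⟩ : (tightSet P c).Nonempty := by
    by_contra hne
    rw [Set.not_nonempty_iff_eq_empty] at hne
    rw [hne, dim_empty] at h4
    omega
  obtain ⟨y, hy, hyt⟩ : ∃ y ∈ P, y ∉ tightSet P c := by
    by_contra! hne
    rw [Set.Subset.antisymm (tightSet_subset P c) hne, h5] at h4
    omega
  have hcy : 0 < c ⬝ᵥ y := lt_of_le_of_ne (hc y hy) fun h => hyt ⟨hy, h.symm⟩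
  have hcy' : 0 < c' ⬝ᵥ y :=
    lt_of_le_of_ne (hc' y hy) fun h' => hyt (by rw [h]; exact ⟨hy, h'.symm⟩)
  -- With this ratio, c' - a c vanishes at y as well as on the tight set, hence has zero linear part
  -- on the span of P. It is therefore a multiple of the all-ones functional, and its value 0 at a
  -- point with coordinate sum N ≠ 0 makes it zero.
  refine ⟨c' ⬝ᵥ y / c ⬝ᵥ y, div_pos hcy' hcy, ?_⟩
  set a := c' ⬝ᵥ y / c ⬝ᵥ y with ha
  have hgt : ∀ x ∈ tightSet P c, (c' - a • c) ⬝ᵥ x = 0 := by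
    intro x hx
    have h1 := hx.2
    rw [h] at hx
    rw [sub_dotProduct, smul_dotProduct, h1, hx.2]
    simp
  have hgy : (c' - a • c) ⬝ᵥ y = 0 := by
    rw [sub_dotProduct, smul_dotProduct, ha, smul_eq_mul, div_mul_cancel₀ _ hcy.ne', sub_self]
  have hker : LinearMap.ker (dotLin 1) ≤ LinearMap.ker (dotLin (c' - a • c)) := by
    have hP : vectorSpan ℝ P = LinearMap.ker (dotLin 1) :=
      Submodule.eq_of_le_of_finrank_eq (vectorSpan_le_ker hN) (by rw [finrank_ker_one]; exact h5)
    have hle : vectorSpan ℝ (insert y (tightSet P c)) ≤ vectorSpan ℝ P :=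
      vectorSpan_mono ℝ (Set.insert_subset hy (tightSet_subset P c))
    have hlt : vectorSpan ℝ (tightSet P c) < vectorSpan ℝ (insert y (tightSet P c)) := by
      refine lt_of_le_of_ne (vectorSpan_mono ℝ (Set.subset_insert _ _)) fun h => hcy.ne' ?_
      have hmem : y - x₀ ∈ vectorSpan ℝ (tightSet P c) := by
        rw [h]
        exact vsub_mem_vectorSpan ℝ (Set.mem_insert _ _) (Set.mem_insert_of_mem _ h₀)
      have := vectorSpan_le_ker (fun x (hx : x ∈ tightSet P c) => hx.2) hmem
      rw [LinearMap.mem_ker, map_sub, dotLin_apply, dotLin_apply, h₀.2, sub_zero] at this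
      exact this
    have h1 := Submodule.finrank_lt_finrank_of_lt hlt
    have heq : vectorSpan ℝ (insert y (tightSet P c)) = vectorSpan ℝ P := by
      refine Submodule.eq_of_le_of_finrank_le hle ?_
      unfold dim at h4 h5
      omega
    rw [← hP, ← heq]
    refine vectorSpan_le_ker (r := 0) ?_
    rintro x (rfl | hx)
    · exact hgy
    · exact hgt x hx
  have hconst : ∀ p q, (c' - a • c) p = (c' - a • c) q := by
    intro p q
    have hmem : Pi.single p 1 - Pi.single q 1 ∈ LinearMap.ker (dotLin 1) := by
      simp [LinearMap.mem_ker]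
    have := hker hmem
    rw [LinearMap.mem_ker, map_sub, dotLin_apply, dotLin_apply, dotProduct_single_one,
      dotProduct_single_one] at this
    linarith
  have hzero : ∀ p, (c' - a • c) p = 0 := by
    intro p
    have h1 := hgt x₀ h₀
    have h2 : (c' - a • c) = (c' - a • c) p • (1 : Transition → ℝ) := by
      funext q
      rw [hconst q p]
      simp
    rw [h2, smul_dotProduct, hN x₀ h₀.1, smul_eq_mul] at h1
    exact (mul_eq_zero.1 h1).resolve_right hN0
  funext p
  have := hzero p
  simp only [Pi.sub_apply] at this
  linarith

/-- If a facet is contained in a tight set of the same dimension, then they are equal. -/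
theorem eq_tightSet_of_subset {P F : Set (Transition → ℝ)} (hF : IsFace P F)
    {c : Transition → ℝ} (hsub : F ⊆ tightSet P c) (hne : F.Nonempty)
    (hdim : dim F = dim (tightSet P c)) : F = tightSet P c := by
  refine hsub.antisymm fun x hx => ?_
  obtain ⟨w, rfl⟩ := hF
  obtain ⟨x₀, h₀⟩ := hne
  -- Equal dimensions give equal directions, so the functional defining F is constant on the whole
  -- tight set.
  have heq := Submodule.eq_of_le_of_finrank_eq (vectorSpan_mono ℝ hsub) hdim
  have hmem : x - x₀ ∈ vectorSpan ℝ (tightSet P c) := vsub_mem_vectorSpan ℝ hx (hsub h₀)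
  rw [← heq] at hmem
  have := vectorSpan_le_ker (c := w) (r := w ⬝ᵥ x₀)
    (fun y hy => le_antisymm (h₀.2 y hy.1) (hy.2 x₀ h₀.1)) hmem
  rw [LinearMap.mem_ker, map_sub, dotLin_apply, dotLin_apply, sub_eq_zero] at this
  exact ⟨hx.1, fun y hy => (h₀.2 y hy).trans_eq this.symm⟩

/-- A nonempty tight set of a valid inequality is a face. -/
theorem isFace_tightSet {P : Set (Transition → ℝ)} {c : Transition → ℝ}
    (hc : ∀ x ∈ P, 0 ≤ c ⬝ᵥ x) (hne : (tightSet P c).Nonempty) : IsFace P (tightSet P c) := by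
  obtain ⟨x₀, h₀⟩ := hne
  refine ⟨-c, ?_⟩
  ext x
  simp only [tightSet, Set.mem_ofPred_eq, neg_dotProduct, neg_le_neg_iff]
  refine and_congr_right fun hx => ⟨fun h y hy => h ▸ hc y hy, fun h => ?_⟩
  exact le_antisymm ((h x₀ h₀.1).trans_eq h₀.2) (hc x hx)

/-- A valid inequality that is tight at all generators at which a linear functional attains its
minimum is tight on the whole face of that functional. -/
theorem tight_of_tight_on_generators {ι : Type*} [Fintype ι] (v : ι → Transition → ℝ)
    {c w : Transition → ℝ} {m : ℝ} (hc : ∀ i, 0 ≤ c ⬝ᵥ v i) (hw : ∀ i, m ≤ w ⬝ᵥ v i)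
    (h : ∀ i, w ⬝ᵥ v i = m → c ⬝ᵥ v i = 0) {x : Transition → ℝ}
    (hx : x ∈ convexHull ℝ (Set.range v)) (hwx : w ⬝ᵥ x ≤ m) : c ⬝ᵥ x ≤ 0 := by
  -- The sum dominates every quotient, so c · v ≤ a (w · v - m) at all generators and hence on their
  -- hull. At minimisers of w the quotient has denominator 0 and the value 0, and the bound is the
  -- hypothesis `h`.
  set a : ℝ := ∑ i, c ⬝ᵥ v i / (w ⬝ᵥ v i - m) with ha
  have hterm : ∀ i, 0 ≤ c ⬝ᵥ v i / (w ⬝ᵥ v i - m) := fun i =>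
    div_nonneg (hc i) (sub_nonneg.2 (hw i))
  have ha0 : 0 ≤ a := Finset.sum_nonneg fun i _ => hterm i
  have hgen : ∀ i, (c - a • w) ⬝ᵥ v i ≤ -(a * m) := by
    intro i
    rw [sub_dotProduct, smul_dotProduct, smul_eq_mul]
    rcases (hw i).lt_or_eq with hlt | heq
    · have h1 : c ⬝ᵥ v i / (w ⬝ᵥ v i - m) ≤ a :=
        Finset.single_le_sum (f := fun i => c ⬝ᵥ v i / (w ⬝ᵥ v i - m)) (fun i _ => hterm i)
          (Finset.mem_univ i)
      rw [div_le_iff₀ (by linarith)] at h1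
      linarith
    · rw [h i heq.symm, ← heq]
      linarith
  have hconv : convexHull ℝ (Set.range v) ⊆ {y | dotLin (c - a • w) y ≤ -(a * m)} := by
    refine convexHull_min ?_ (convex_halfSpace_le (dotLin (c - a • w)).isLinear _)
    rintro _ ⟨i, rfl⟩
    exact hgen i
  have h1 : (c - a • w) ⬝ᵥ x ≤ -(a * m) := hconv hx
  rw [sub_dotProduct, smul_dotProduct, smul_eq_mul] at h1
  have := mul_le_mul_of_nonneg_left hwx ha0
  linarith

theorem nonneg_of_nonneg_on_generators {ι : Type*} (v : ι → Transition → ℝ)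
    {c : Transition → ℝ} {m : ℝ} (hc : ∀ i, m ≤ c ⬝ᵥ v i) {x : Transition → ℝ}
    (hx : x ∈ convexHull ℝ (Set.range v)) : m ≤ c ⬝ᵥ x := by
  have hconv : convexHull ℝ (Set.range v) ⊆ {y | m ≤ dotLin c y} := by
    refine convexHull_min ?_ (convex_halfSpace_ge (dotLin c).isLinear _)
    rintro _ ⟨i, rfl⟩
    exact hc i
  exact hconv hx

/-! ### The polytope as the convex hull of flow vectors -/

/-- The vector of transition counts of a flow. -/
def flowVec (z : Fin 3 → Fin 3 → ℤ) : Transition → ℝ := fun p => z p.1.1 p.1.2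

theorem col_eq_flowVec {n : ℕ} (w : Word (n + 1)) :
    (designMatrix (n + 1)).col w = flowVec (countZ w.1) := by
  funext p
  have := transitionCount_eq_countZ w p
  simp only [Matrix.col_apply, designMatrix, Matrix.of_apply, flowVec]
  exact_mod_cast this

theorem flowVec_congr {z z' : Fin 3 → Fin 3 → ℤ} (h : ∀ i j, i ≠ j → z i j = z' i j) :
    flowVec z = flowVec z' := by
  funext p
  simp only [flowVec]
  rw [h _ _ p.2]

theorem flowVec_mem {n : ℕ} (hn : 0 < n) {z : Fin 3 → Fin 3 → ℤ} (hz : IsFlow n z) :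
    flowVec z ∈ designPolytope (n + 1) := by
  obtain ⟨w, hw⟩ := exists_word_of_isFlow hn hz
  refine subset_convexHull ℝ _ ⟨w, ?_⟩
  rw [← flowVec_congr hw]
  exact col_eq_flowVec w

theorem designPolytope_eq (n : ℕ) : designPolytope (n + 1) =
    convexHull ℝ (Set.range fun w : Word (n + 1) => flowVec (countZ w.1)) := by
  unfold designPolytope
  simp only [col_eq_flowVec]

theorem dotProduct_transition (c x : Transition → ℝ) : c ⬝ᵥ x =
    c ⟨(0, 1), by decide⟩ * x ⟨(0, 1), by decide⟩ + c ⟨(0, 2), by decide⟩ * x ⟨(0, 2), by decide⟩ +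
    c ⟨(1, 0), by decide⟩ * x ⟨(1, 0), by decide⟩ + c ⟨(1, 2), by decide⟩ * x ⟨(1, 2), by decide⟩ +
    c ⟨(2, 0), by decide⟩ * x ⟨(2, 0), by decide⟩ + c ⟨(2, 1), by decide⟩ * x ⟨(2, 1), by decide⟩ :=
  sum_transition _

theorem vec_dotProduct_flowVec (a b c d e f : ℝ) (z : Fin 3 → Fin 3 → ℤ) :
    vec a b c d e f ⬝ᵥ flowVec z =
      a * z 0 1 + b * z 0 2 + c * z 1 0 + d * z 1 2 + e * z 2 0 + f * z 2 1 := by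
  rw [dotProduct_transition]
  rfl

theorem one_dotProduct_flowVec {n : ℤ} {z : Fin 3 → Fin 3 → ℤ} (hz : IsFlow n z) :
    1 ⬝ᵥ flowVec z = n := by
  rw [dotProduct_transition]
  simp only [Pi.one_apply, one_mul, flowVec]
  have := hz.2.1
  exact_mod_cast this

theorem one_dotProduct_of_mem {n : ℕ} {x : Transition → ℝ} (hx : x ∈ designPolytope (n + 1)) :
    1 ⬝ᵥ x = n := by
  rw [designPolytope_eq] at hx
  have h1 := nonneg_of_nonneg_on_generators (c := 1) (m := n) _
    (fun w : Word (n + 1) => (one_dotProduct_flowVec (isFlow_countZ w)).ge) hx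
  have h2 := nonneg_of_nonneg_on_generators (c := -1) (m := -n) _
    (fun w : Word (n + 1) => by
      rw [neg_dotProduct, one_dotProduct_flowVec (isFlow_countZ w)]; simp) hx
  rw [neg_dotProduct] at h2
  linarith

theorem isFlow_iff {n : ℤ} {z : Fin 3 → Fin 3 → ℤ} {i j k : Fin 3} (hij : i ≠ j) (hik : i ≠ k)
    (hjk : j ≠ k) : IsFlow n z ↔ FlowT n (z i j) (z i k) (z j i) (z j k) (z k i) (z k j) := by
  revert hij hik hjk
  unfold IsFlow FlowT
  fin_cases i <;> fin_cases j <;> fin_cases k <;> simp <;> omega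

/-- The flow with the given values. -/
def flowOf (a b c d e f : ℤ) : Fin 3 → Fin 3 → ℤ :=
  ![![0, a, b], ![c, 0, d], ![e, f, 0]]

theorem isFlow_flowOf {n a b c d e f : ℤ} : IsFlow n (flowOf a b c d e f) ↔ FlowT n a b c d e f :=
  Iff.rfl

/-! ### Relabelling and time reversal as symmetries of the polytope -/

section Symmetry

/-- The permutation of the transitions induced by a relabelling of the states. -/
def relabelEquiv (σ : Equiv.Perm (Fin 3)) : Equiv.Perm Transition where
  toFun p := ⟨(σ p.1.1, σ p.1.2), fun h => p.2 (σ.injective h)⟩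
  invFun p := ⟨(σ.symm p.1.1, σ.symm p.1.2), fun h => p.2 (σ.symm.injective h)⟩
  left_inv p := by simp
  right_inv p := by simp

/-- The permutation of the transitions induced by the reversal of time. -/
def reverseEquiv : Equiv.Perm Transition where
  toFun p := ⟨(p.1.2, p.1.1), p.2.symm⟩
  invFun p := ⟨(p.1.2, p.1.1), p.2.symm⟩
  left_inv _ := rfl
  right_inv _ := rfl

theorem relabel_eq (σ : Equiv.Perm (Fin 3)) (c : Transition → ℝ) :
    relabel σ c = c ∘ relabelEquiv σ := rfl

theorem reverse_eq (c : Transition → ℝ) : reverse c = c ∘ reverseEquiv := rfl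

/-- The permutation `e` of the coordinates and its inverse preserve `P`. -/
def Preserves (P : Set (Transition → ℝ)) (e : Equiv.Perm Transition) : Prop :=
  ∀ x, x ∘ e ∈ P ↔ x ∈ P

theorem Preserves.trans {P : Set (Transition → ℝ)} {e e' : Equiv.Perm Transition}
    (h : Preserves P e) (h' : Preserves P e') : Preserves P (e.trans e') :=
  fun x => (h (x ∘ e')).trans (h' x)

theorem comp_dotProduct (c x : Transition → ℝ) (e : Equiv.Perm Transition) :
    (c ∘ e) ⬝ᵥ x = c ⬝ᵥ (x ∘ e.symm) := by
  unfold dotProduct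
  rw [← Equiv.sum_comp e fun p => c p * (x ∘ e.symm) p]
  simp

theorem Preserves.symm_mem {P : Set (Transition → ℝ)} {e : Equiv.Perm Transition}
    (h : Preserves P e) {x : Transition → ℝ} : x ∘ e.symm ∈ P ↔ x ∈ P := by
  rw [← h (x ∘ e.symm), Function.comp_assoc, Equiv.symm_comp_self, Function.comp_id]

theorem tightSet_comp {P : Set (Transition → ℝ)} {e : Equiv.Perm Transition} (h : Preserves P e)
    (c : Transition → ℝ) :
    tightSet P (c ∘ e) = (LinearEquiv.funCongrLeft ℝ ℝ e) '' tightSet P c := by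
  ext x
  constructor
  · rintro ⟨hx, h0⟩
    refine ⟨x ∘ e.symm, ⟨h.symm_mem.2 hx, by rw [← comp_dotProduct]; exact h0⟩, ?_⟩
    funext p
    simp [LinearEquiv.funCongrLeft_apply, LinearMap.funLeft_apply]
  · rintro ⟨y, ⟨hy, h0⟩, rfl⟩
    refine ⟨(h y).2 hy, ?_⟩
    rw [comp_dotProduct]
    convert h0 using 2
    funext p
    simp [LinearEquiv.funCongrLeft_apply, LinearMap.funLeft_apply]

theorem dim_image (L : (Transition → ℝ) ≃ₗ[ℝ] (Transition → ℝ)) (S : Set (Transition → ℝ)) :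
    dim (L '' S) = dim S := by
  unfold dim
  have : vectorSpan ℝ (L '' S) = (vectorSpan ℝ S).map L.toLinearMap := by
    have := AffineMap.map_vectorSpan (L.toLinearMap.toAffineMap) (s := S)
    simpa using this.symm
  rw [this]
  exact LinearEquiv.finrank_map_eq L _

theorem dim_tightSet_comp {P : Set (Transition → ℝ)} {e : Equiv.Perm Transition}
    (h : Preserves P e) (c : Transition → ℝ) : dim (tightSet P (c ∘ e)) = dim (tightSet P c) := by
  rw [tightSet_comp h, dim_image]

theorem comp_mem_of_flow {n : ℕ} {e : Equiv.Perm Transition}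
    (h : ∀ z, IsFlow n z → flowVec z ∘ e ∈ designPolytope (n + 1)) {x : Transition → ℝ}
    (hx : x ∈ designPolytope (n + 1)) : x ∘ e ∈ designPolytope (n + 1) := by
  rw [designPolytope_eq] at hx
  have : convexHull ℝ (Set.range fun w : Word (n + 1) => flowVec (countZ w.1)) ⊆
      LinearMap.funLeft ℝ ℝ e ⁻¹' designPolytope (n + 1) := by
    refine convexHull_min ?_ ((convex_convexHull ℝ _).linear_preimage _)
    rintro _ ⟨w, rfl⟩
    exact h _ (isFlow_countZ w)
  exact this hx

theorem preserves_relabel {n : ℕ} (hn : 0 < n) (σ : Equiv.Perm (Fin 3)) :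
    Preserves (designPolytope (n + 1)) (relabelEquiv σ) := by
  have key : ∀ (σ : Equiv.Perm (Fin 3)) x, x ∈ designPolytope (n + 1) →
      x ∘ relabelEquiv σ ∈ designPolytope (n + 1) := by
    intro σ x hx
    refine comp_mem_of_flow (fun z hz => ?_) hx
    exact flowVec_mem (z := fun i j => z (σ i) (σ j)) hn
      ((isFlow_iff (i := σ 0) (j := σ 1) (k := σ 2) (by simp) (by simp) (by simp)).1 hz)
  refine fun x => ⟨fun hx => ?_, key σ x⟩
  have := key σ.symm _ hx
  convert this using 1
  funext p
  simp [relabelEquiv]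

theorem preserves_reverse {n : ℕ} (hn : 0 < n) :
    Preserves (designPolytope (n + 1)) reverseEquiv := by
  have key : ∀ x, x ∈ designPolytope (n + 1) → x ∘ reverseEquiv ∈ designPolytope (n + 1) := by
    intro x hx
    refine comp_mem_of_flow (fun z hz => ?_) hx
    refine flowVec_mem (z := fun i j => z j i) hn ?_
    change FlowT n (z 1 0) (z 2 0) (z 0 1) (z 2 1) (z 0 2) (z 1 2)
    unfold IsFlow FlowT at *
    omega
  exact fun x => ⟨fun hx => key _ hx, key x⟩

theorem exists_preserves_of_mem_facetVectors {n : ℕ} (hn : 0 < n) {c : Transition → ℝ}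
    (hc : c ∈ facetVectors (n + 1)) : ∃ b ∈ tableVectors (n + 1), ∃ e : Equiv.Perm Transition,
      Preserves (designPolytope (n + 1)) e ∧ c = b ∘ e := by
  obtain ⟨b, hb, σ, rfl | rfl⟩ := hc
  · exact ⟨b, hb, relabelEquiv σ, preserves_relabel hn σ, rfl⟩
  · exact ⟨b, hb, reverseEquiv.trans (relabelEquiv σ),
      (preserves_reverse hn).trans (preserves_relabel hn σ), rfl⟩

end Symmetry

/-! ### Integral affine forms behind the table -/

/-- The integral linear forms, up to relabelling and reversal, that define the facets for words
of length `n + 1`. -/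
inductive IsForm (n : ℕ) : ((Fin 3 → Fin 3 → ℤ) → ℤ) → Prop
  | edge : IsForm n fun z => z 0 1
  | hex : IsForm n fun z => 1 + z 0 1 + z 0 2 - z 1 0 - z 2 0
  | even (h : n % 2 = 0) : IsForm n fun z => n - 2 * (z 1 0 + z 1 2)
  | odd (h : n % 2 = 1) : IsForm n fun z => 2 * (2 * z 0 1 + z 0 2 + z 2 1) - (n - 1)
  | three (h : n % 3 ≠ 2) : IsForm n fun z => z 0 1 + z 2 0 + z 2 1 - n / 3
  | three' (h : n % 3 = 2) : IsForm n fun z =>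
      3 * (3 * z 0 1 + 2 * z 0 2 + z 1 2 + z 2 0 + 2 * z 2 1) - (4 * n - 2)

section Dot

variable {n : ℕ} {z : Fin 3 → Fin 3 → ℤ}

theorem IsFlow.cast_sum (hz : IsFlow n z) :
    (n : ℝ) = z 0 1 + z 0 2 + z 1 0 + z 1 2 + z 2 0 + z 2 1 := by
  have := hz.2.1
  exact_mod_cast this.symm

theorem dot_edge : vec 1 0 0 0 0 0 ⬝ᵥ flowVec z = 1 * ((z 0 1 : ℤ) : ℝ) := by
  rw [vec_dotProduct_flowVec]; ring

/-- On flows n is the sum of the counts, which turns the constant term of the form into a linear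
one. Apart from `dot_edge`, which has no constant, all these identities are such homogenisations,
the factor accounting for the table's normalisation. -/
theorem dot_hex (hz : IsFlow n z) {T : ℝ} (hT : T = n + 1) :
    vec T T (-(T - 2)) 1 (-(T - 2)) 1 ⬝ᵥ flowVec z =
      n * ((1 + z 0 1 + z 0 2 - z 1 0 - z 2 0 : ℤ) : ℝ) := by
  rw [vec_dotProduct_flowVec, hT]
  push_cast
  have := hz.cast_sum
  generalize (n : ℝ) = N at *
  subst this
  ring

theorem dot_even (hz : IsFlow n z) : vec 1 1 (-1) (-1) 1 1 ⬝ᵥ flowVec z =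
    1 * ((n - 2 * (z 1 0 + z 1 2) : ℤ) : ℝ) := by
  rw [vec_dotProduct_flowVec]
  push_cast
  rw [hz.cast_sum]
  ring

theorem dot_odd (hz : IsFlow n z) {T : ℝ} (hT : T = n + 1) :
    vec (3 / 2 * T - 1) (T / 2) (-T / 2 + 1) (-T / 2 + 1) (-T / 2 + 1) (T / 2) ⬝ᵥ flowVec z =
      n / 2 * ((2 * (2 * z 0 1 + z 0 2 + z 2 1) - (n - 1) : ℤ) : ℝ) := by
  rw [vec_dotProduct_flowVec, hT]
  push_cast
  have := hz.cast_sum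
  generalize (n : ℝ) = N at *
  subst this
  ring

theorem dot_three_zero (hz : IsFlow n z) {k : ℕ} (hk : n = 3 * k) :
    vec 2 (-1) (-1) (-1) 2 2 ⬝ᵥ flowVec z =
      3 * ((z 0 1 + z 2 0 + z 2 1 - n / 3 : ℤ) : ℝ) := by
  have h3 : (n : ℤ) / 3 = k := by omega
  rw [vec_dotProduct_flowVec, h3]
  push_cast
  have := hz.cast_sum
  rw [hk] at this
  push_cast at this
  linarith

theorem dot_three_one (hz : IsFlow n z) {k : ℕ} (hk : n = 3 * k + 1) :
    vec (2 * (k : ℝ) + 1) (-(k : ℝ)) (-(k : ℝ)) (-(k : ℝ)) (2 * (k : ℝ) + 1) (2 * (k : ℝ) + 1) ⬝ᵥ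
      flowVec z = n * ((z 0 1 + z 2 0 + z 2 1 - n / 3 : ℤ) : ℝ) := by
  have h3 : (n : ℤ) / 3 = k := by omega
  have hk' : (n : ℝ) = 3 * k + 1 := by rw [hk]; push_cast; ring
  rw [vec_dotProduct_flowVec, h3]
  push_cast
  have := hz.cast_sum
  rw [hk']
  rw [hk'] at this
  linear_combination (k : ℝ) * this

theorem dot_three_two (hz : IsFlow n z) {k : ℕ} (hk : n = 6 * k + 2) :
    vec (5 * (k : ℝ) + 2) (2 * (k : ℝ) + 1) (-4 * (k : ℝ) - 1) (-(k : ℝ)) (-(k : ℝ))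
      (2 * (k : ℝ) + 1) ⬝ᵥ flowVec z = (3 * k + 1) / 3 *
      ((3 * (3 * z 0 1 + 2 * z 0 2 + z 1 2 + z 2 0 + 2 * z 2 1) - (4 * n - 2) : ℤ) : ℝ) := by
  have hk' : (n : ℝ) = 6 * k + 2 := by rw [hk]; push_cast; ring
  rw [vec_dotProduct_flowVec]
  push_cast
  have := hz.cast_sum
  rw [hk']
  rw [hk'] at this
  linear_combination (4 * (k : ℝ) + 1) * this

theorem dot_three_two' (hz : IsFlow n z) {k : ℕ} (hk : n + 1 = 6 * k) :
    vec (10 * (k : ℝ) - 1) (4 * (k : ℝ)) (-8 * (k : ℝ) + 2) (-2 * (k : ℝ) + 1) (-2 * (k : ℝ) + 1)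
      (4 * (k : ℝ)) ⬝ᵥ flowVec z = n / 3 *
      ((3 * (3 * z 0 1 + 2 * z 0 2 + z 1 2 + z 2 0 + 2 * z 2 1) - (4 * n - 2) : ℤ) : ℝ) := by
  have hk' : (n : ℝ) = 6 * k - 1 := by
    have : (n : ℝ) + 1 = 6 * k := by exact_mod_cast hk
    linarith
  rw [vec_dotProduct_flowVec]
  push_cast
  have := hz.cast_sum
  rw [hk']
  rw [hk'] at this
  linear_combination (8 * (k : ℝ) - 2) * this

end Dot

/-- `b` is on flows of length `n` a positive multiple of `F`. -/
def Represents (n : ℕ) (b : Transition → ℝ) (F : (Fin 3 → Fin 3 → ℤ) → ℤ) : Prop :=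
  ∃ a : ℝ, 0 < a ∧ ∀ z, IsFlow n z → b ⬝ᵥ flowVec z = a * (F z : ℝ)

theorem exists_form_of_mem_tableVectors {n : ℕ} (hn : 0 < n) {b : Transition → ℝ}
    (hb : b ∈ tableVectors (n + 1)) : ∃ F, IsForm n F ∧ Represents n b F := by
  have hn' : (0 : ℝ) < n := by exact_mod_cast hn
  rcases hb with rfl | rfl | ⟨h, rfl⟩ | ⟨h, rfl⟩ | ⟨k, hk, rfl⟩ | ⟨k, hk, rfl⟩ | ⟨k, hk, rfl⟩ |
    ⟨k, hk, rfl⟩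
  · exact ⟨_, .edge, 1, one_pos, fun z _ => dot_edge⟩
  · exact ⟨_, .hex, n, hn', fun z hz => dot_hex hz (by push_cast; ring)⟩
  · rw [Nat.odd_iff] at h
    exact ⟨_, .even (by omega), 1, one_pos, fun z hz => dot_even hz⟩
  · rw [Nat.even_iff] at h
    exact ⟨_, .odd (by omega), n / 2, by positivity,
      fun z hz => dot_odd hz (by push_cast; ring)⟩
  · exact ⟨_, .three (by omega), 3, by norm_num,
      fun z hz => dot_three_zero (k := k) hz (by omega)⟩
  · exact ⟨_, .three (by omega), n, hn',
      fun z hz => dot_three_one hz (by omega)⟩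
  · exact ⟨_, .three' (by omega), (3 * k + 1) / 3,
      by positivity, fun z hz => dot_three_two hz (by omega)⟩
  · exact ⟨_, .three' (by omega), n / 3,
      by positivity, fun z hz => dot_three_two' hz (by omega)⟩

theorem exists_mem_tableVectors_of_form {n : ℕ} (hn : 0 < n) {F : (Fin 3 → Fin 3 → ℤ) → ℤ}
    (hF : IsForm n F) : ∃ b ∈ tableVectors (n + 1), Represents n b F := by
  have hn' : (0 : ℝ) < n := by exact_mod_cast hn
  rcases hF with _ | _ | h | h | h | h
  · exact ⟨_, Or.inl rfl, 1, one_pos, fun z _ => dot_edge⟩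
  · exact ⟨_, Or.inr (Or.inl rfl), n, hn', fun z hz => dot_hex hz (by push_cast; ring)⟩
  · exact ⟨_, Or.inr (Or.inr (Or.inl ⟨by rw [Nat.odd_iff]; omega, rfl⟩)), 1, one_pos,
      fun z hz => dot_even hz⟩
  · exact ⟨_, Or.inr (Or.inr (Or.inr (Or.inl ⟨by rw [Nat.even_iff]; omega, rfl⟩))), n / 2,
      by positivity, fun z hz => dot_odd hz (by push_cast; ring)⟩
  · rcases (show n % 3 = 0 ∨ n % 3 = 1 by omega) with h' | h'
    · exact ⟨_, Or.inr (Or.inr (Or.inr (Or.inr (Or.inl ⟨n / 3, by omega, rfl⟩)))), 3, by norm_num,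
        fun z hz => dot_three_zero (k := n / 3) hz (by omega)⟩
    · exact ⟨_, Or.inr (Or.inr (Or.inr (Or.inr (Or.inr (Or.inl ⟨n / 3, by omega, rfl⟩))))), n, hn',
        fun z hz => dot_three_one hz (by omega)⟩
  · rcases (show n % 6 = 2 ∨ n % 6 = 5 by omega) with h' | h'
    · exact ⟨_, Or.inr (Or.inr (Or.inr (Or.inr (Or.inr (Or.inr (Or.inl ⟨n / 6, by omega, rfl⟩)))))),
        (3 * (n / 6 : ℕ) + 1) / 3, by positivity, fun z hz => dot_three_two hz (by omega)⟩
    · exact ⟨_, Or.inr (Or.inr (Or.inr (Or.inr (Or.inr (Or.inr (Or.inr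
        ⟨(n + 1) / 6, by omega, rfl⟩)))))),
        n / 3, by positivity, fun z hz => dot_three_two' hz (by omega)⟩

/-- Combining the divergence bounds with nonnegativity gives lower bounds that may be slightly
negative; integrality and the congruences of n modulo 2 and 3 close the gap. -/
theorem IsForm.nonneg {n : ℕ} {F : (Fin 3 → Fin 3 → ℤ) → ℤ} (hF : IsForm n F)
    {z : Fin 3 → Fin 3 → ℤ} (hz : IsFlow n z) : 0 ≤ F z := by
  unfold IsFlow FlowT at hz
  cases hF <;> dsimp only <;> omega

/-! ### From covering hyperplanes to facet vectors -/

section Covered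

theorem relabel_symm_dotProduct (τ : Equiv.Perm (Fin 3)) (b : Transition → ℝ)
    (z : Fin 3 → Fin 3 → ℤ) :
    relabel τ.symm b ⬝ᵥ flowVec z = b ⬝ᵥ flowVec fun i j => z (τ i) (τ j) := by
  rw [relabel_eq, comp_dotProduct]
  rfl

theorem reverse_dotProduct (b : Transition → ℝ) (z : Fin 3 → Fin 3 → ℤ) :
    reverse b ⬝ᵥ flowVec z = b ⬝ᵥ flowVec fun i j => z j i := by
  rw [reverse_eq, comp_dotProduct]
  rfl

variable {n : ℕ} {O : (Fin 3 → Fin 3 → ℤ) → Prop}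

theorem exists_mem_of_form (hn : 0 < n) (hO : ∀ z, O z → IsFlow n z)
    {F : (Fin 3 → Fin 3 → ℤ) → ℤ} (hF : IsForm n F) (τ : Equiv.Perm (Fin 3))
    (h : ∀ z, O z → F (fun i j => z (τ i) (τ j)) = 0) :
    ∃ c ∈ facetVectors (n + 1), ∀ z, O z → c ⬝ᵥ flowVec z = 0 := by
  obtain ⟨b, hb, a, -, hab⟩ := exists_mem_tableVectors_of_form hn hF
  refine ⟨relabel τ.symm b, ⟨b, hb, τ.symm, Or.inl rfl⟩, fun z hz => ?_⟩
  rw [relabel_symm_dotProduct, hab, h z hz, Int.cast_zero, mul_zero]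
  exact (isFlow_iff (i := τ 0) (j := τ 1) (k := τ 2) (by simp) (by simp) (by simp)).1 (hO z hz)

theorem exists_mem_of_form_reverse (hn : 0 < n) (hO : ∀ z, O z → IsFlow n z)
    {F : (Fin 3 → Fin 3 → ℤ) → ℤ} (hF : IsForm n F) (τ : Equiv.Perm (Fin 3))
    (h : ∀ z, O z → F (fun i j => z (τ j) (τ i)) = 0) :
    ∃ c ∈ facetVectors (n + 1), ∀ z, O z → c ⬝ᵥ flowVec z = 0 := by
  obtain ⟨b, hb, a, -, hab⟩ := exists_mem_tableVectors_of_form hn hF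
  refine ⟨reverse (relabel τ.symm b), ⟨b, hb, τ.symm, Or.inr rfl⟩, fun z hz => ?_⟩
  rw [reverse_dotProduct, relabel_symm_dotProduct, hab, h z hz, Int.cast_zero, mul_zero]
  have hf := (isFlow_iff (i := τ 0) (j := τ 1) (k := τ 2) (by simp) (by simp) (by simp)).1 (hO z hz)
  change FlowT n (z (τ 1) (τ 0)) (z (τ 2) (τ 0)) (z (τ 0) (τ 1)) (z (τ 2) (τ 1)) (z (τ 0) (τ 2))
    (z (τ 1) (τ 2))
  unfold FlowT at *
  omega

theorem exists_perm {i j k : Fin 3} (hij : i ≠ j) (hik : i ≠ k) (hjk : j ≠ k) :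
    ∃ τ : Equiv.Perm (Fin 3), τ 0 = i ∧ τ 1 = j ∧ τ 2 = k := by
  revert i j k
  decide

/-- The members of a covered set of flows lie on the hyperplane of one of the facet vectors. -/
theorem exists_mem_facetVectors_of_covered (hn : 0 < n) (hO : ∀ z, O z → IsFlow n z)
    (h : Covered n O) : ∃ c ∈ facetVectors (n + 1), ∀ z, O z → c ⬝ᵥ flowVec z = 0 := by
  obtain ⟨i, j, k, hij, hik, hjk, h⟩ := h
  obtain ⟨τ, rfl, rfl, rfl⟩ := exists_perm hij hik hjk
  -- `IsForm.even` concerns state 1 while `Covered` concerns i, hence the exchange of the first two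
  -- states. Time reversal is needed only for source versus sink and for outflow versus inflow; for
  -- the remaining forms it acts on the orbit like a relabelling.
  obtain ⟨ρ, h0, h1, h2⟩ := exists_perm hij.symm hjk hik
  rcases h with h | h | h | ⟨hm, h⟩ | ⟨hm, h⟩ | ⟨hm, h⟩ | ⟨hm, h⟩ | ⟨hm, h⟩
  · exact exists_mem_of_form hn hO .edge τ fun z hz => h z hz
  · refine exists_mem_of_form_reverse hn hO .hex τ fun z hz => ?_
    have := h z hz
    dsimp only
    omega
  · refine exists_mem_of_form hn hO .hex τ fun z hz => ?_
    have := h z hz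
    dsimp only
    omega
  · refine exists_mem_of_form hn hO (.even (by omega)) ρ fun z hz => ?_
    have := h z hz
    dsimp only
    rw [h0, h1, h2]
    omega
  · refine exists_mem_of_form_reverse hn hO (.even (by omega)) ρ
      fun z hz => ?_
    have := h z hz
    dsimp only
    rw [h0, h1, h2]
    omega
  · refine exists_mem_of_form hn hO (.odd (by omega)) τ
      fun z hz => ?_
    have := h z hz
    dsimp only
    omega
  · refine exists_mem_of_form hn hO
      (.three (by omega)) τ fun z hz => ?_
    have := h z hz
    dsimp only
    omega
  · refine exists_mem_of_form hn hO
      (.three' (by omega)) τ fun z hz => ?_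
    have := h z hz
    dsimp only
    omega

end Covered

/-! ### Affinely independent flows on every hyperplane -/

/-- Five flows on the hyperplane `F = 0` whose count vectors are affinely independent. -/
def HasFrame (n : ℕ) (F : (Fin 3 → Fin 3 → ℤ) → ℤ) : Prop :=
  ∃ z₀ z₁ z₂ z₃ z₄ : Fin 3 → Fin 3 → ℤ, (IsFlow n z₀ ∧ F z₀ = 0) ∧ (IsFlow n z₁ ∧ F z₁ = 0) ∧
    (IsFlow n z₂ ∧ F z₂ = 0) ∧ (IsFlow n z₃ ∧ F z₃ = 0) ∧ (IsFlow n z₄ ∧ F z₄ = 0) ∧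
    LinearIndependent ℝ ![flowVec z₁ - flowVec z₀, flowVec z₂ - flowVec z₀,
      flowVec z₃ - flowVec z₀, flowVec z₄ - flowVec z₀]

theorem linearIndependent_flowVec_sub {z₀ z₁ z₂ z₃ z₄ : Fin 3 → Fin 3 → ℤ}
    (H : ∀ g₁ g₂ g₃ g₄ : ℝ, (∀ i j, i ≠ j → g₁ * (z₁ i j - z₀ i j) + g₂ * (z₂ i j - z₀ i j) +
      g₃ * (z₃ i j - z₀ i j) + g₄ * (z₄ i j - z₀ i j) = 0) →
      g₁ = 0 ∧ g₂ = 0 ∧ g₃ = 0 ∧ g₄ = 0) :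
    LinearIndependent ℝ ![flowVec z₁ - flowVec z₀, flowVec z₂ - flowVec z₀,
      flowVec z₃ - flowVec z₀, flowVec z₄ - flowVec z₀] := by
  rw [Fintype.linearIndependent_iff]
  intro g hg
  obtain ⟨h1, h2, h3, h4⟩ := H (g 0) (g 1) (g 2) (g 3) fun i j hij => by
    have := congrFun hg ⟨(i, j), hij⟩
    simpa [Fin.sum_univ_four, flowVec] using this
  intro i
  fin_cases i
  exacts [h1, h2, h3, h4]

section FlowOf

variable (a b c d e f : ℤ)

theorem flowOf_01 : flowOf a b c d e f 0 1 = a := rfl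
theorem flowOf_02 : flowOf a b c d e f 0 2 = b := rfl
theorem flowOf_10 : flowOf a b c d e f 1 0 = c := rfl
theorem flowOf_12 : flowOf a b c d e f 1 2 = d := rfl
theorem flowOf_20 : flowOf a b c d e f 2 0 = e := rfl
theorem flowOf_21 : flowOf a b c d e f 2 1 = f := rfl

end FlowOf

/-- Criterion for five flows given by their values to be a frame. -/
theorem hasFrame_of {n : ℕ} {F : (Fin 3 → Fin 3 → ℤ) → ℤ} (z₀ z₁ z₂ z₃ z₄ : Fin 3 → Fin 3 → ℤ)
    (h : (IsFlow n z₀ ∧ F z₀ = 0) ∧ (IsFlow n z₁ ∧ F z₁ = 0) ∧ (IsFlow n z₂ ∧ F z₂ = 0) ∧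
      (IsFlow n z₃ ∧ F z₃ = 0) ∧ (IsFlow n z₄ ∧ F z₄ = 0))
    (H : ∀ g₁ g₂ g₃ g₄ : ℝ,
      g₁ * (z₁ 0 1 - z₀ 0 1) + g₂ * (z₂ 0 1 - z₀ 0 1) + g₃ * (z₃ 0 1 - z₀ 0 1) +
        g₄ * (z₄ 0 1 - z₀ 0 1) = 0 →
      g₁ * (z₁ 0 2 - z₀ 0 2) + g₂ * (z₂ 0 2 - z₀ 0 2) + g₃ * (z₃ 0 2 - z₀ 0 2) +
        g₄ * (z₄ 0 2 - z₀ 0 2) = 0 →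
      g₁ * (z₁ 1 0 - z₀ 1 0) + g₂ * (z₂ 1 0 - z₀ 1 0) + g₃ * (z₃ 1 0 - z₀ 1 0) +
        g₄ * (z₄ 1 0 - z₀ 1 0) = 0 →
      g₁ * (z₁ 1 2 - z₀ 1 2) + g₂ * (z₂ 1 2 - z₀ 1 2) + g₃ * (z₃ 1 2 - z₀ 1 2) +
        g₄ * (z₄ 1 2 - z₀ 1 2) = 0 →
      g₁ * (z₁ 2 0 - z₀ 2 0) + g₂ * (z₂ 2 0 - z₀ 2 0) + g₃ * (z₃ 2 0 - z₀ 2 0) +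
        g₄ * (z₄ 2 0 - z₀ 2 0) = 0 →
      g₁ * (z₁ 2 1 - z₀ 2 1) + g₂ * (z₂ 2 1 - z₀ 2 1) + g₃ * (z₃ 2 1 - z₀ 2 1) +
        g₄ * (z₄ 2 1 - z₀ 2 1) = 0 → g₁ = 0 ∧ g₂ = 0 ∧ g₃ = 0 ∧ g₄ = 0) : HasFrame n F :=
  ⟨z₀, z₁, z₂, z₃, z₄, h.1, h.2.1, h.2.2.1, h.2.2.2.1, h.2.2.2.2,
    linearIndependent_flowVec_sub fun g₁ g₂ g₃ g₄ hg => H g₁ g₂ g₃ g₄ (hg 0 1 (by decide))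
      (hg 0 2 (by decide)) (hg 1 0 (by decide)) (hg 1 2 (by decide)) (hg 2 0 (by decide))
      (hg 2 1 (by decide))⟩

-- The five flows consist of flows of the least admissible length ≥ 4 in the residue class, extended
-- by h turns around a common 2-cycle or 3-cycle. Their differences do not involve h, so
-- independence is a fixed numerical linear system.
set_option linter.unusedSimpArgs false in
theorem IsForm.hasFrame {n : ℕ} (hn : 4 ≤ n) {F : (Fin 3 → Fin 3 → ℤ) → ℤ} (hF : IsForm n F) :
    HasFrame n F := by
  have hpar : (∃ h : ℤ, 0 ≤ h ∧ (n : ℤ) = 2 * h + 4) ∨ ∃ h : ℤ, 0 ≤ h ∧ (n : ℤ) = 2 * h + 5 := by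
    rcases Int.emod_two_eq_zero_or_one n with h | h
    · exact Or.inl ⟨(n - 4) / 2, by omega, by omega⟩
    · exact Or.inr ⟨(n - 5) / 2, by omega, by omega⟩
  cases hF with
  | edge =>
    rcases hpar with ⟨h, hh, hnh⟩ | ⟨h, hh, hnh⟩
    · refine hasFrame_of (flowOf 0 1 1 h 1 (h + 1))
        (flowOf 0 1 0 (h + 1) 1 (h + 1)) (flowOf 0 1 1 (h + 1) 0 (h + 1))
        (flowOf 0 1 0 (h + 1) 2 h) (flowOf 0 2 0 h 1 (h + 1)) ?_ ?_
      · simp only [isFlow_flowOf, flowOf_01, flowOf_02, flowOf_10, flowOf_12, flowOf_20, flowOf_21,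
          FlowT, and_true]
        omega
      · simp only [flowOf_01, flowOf_02, flowOf_10, flowOf_12, flowOf_20, flowOf_21]
        push_cast
        intros
        refine ⟨?_, ?_, ?_, ?_⟩ <;> linarith
    · refine hasFrame_of (flowOf 0 1 1 (h + 1) 1 (h + 1))
        (flowOf 0 1 0 (h + 1) 1 (h + 2)) (flowOf 0 2 1 h 1 (h + 1))
        (flowOf 0 1 1 (h + 1) 0 (h + 2)) (flowOf 0 1 0 (h + 2) 1 (h + 1)) ?_ ?_
      · simp only [isFlow_flowOf, flowOf_01, flowOf_02, flowOf_10, flowOf_12, flowOf_20, flowOf_21,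
          FlowT, and_true]
        omega
      · simp only [flowOf_01, flowOf_02, flowOf_10, flowOf_12, flowOf_20, flowOf_21]
        push_cast
        intros
        refine ⟨?_, ?_, ?_, ?_⟩ <;> linarith
  | hex =>
    rcases hpar with ⟨h, hh, hnh⟩ | ⟨h, hh, hnh⟩
    · refine hasFrame_of (flowOf h 1 (h + 1) 0 1 1)
        (flowOf (h + 1) 0 (h + 1) 1 1 0) (flowOf h 1 h 1 2 0)
        (flowOf h 0 (h + 1) 1 0 2) (flowOf h 1 (h + 2) 0 0 1) ?_ ?_
      · simp only [isFlow_flowOf, flowOf_01, flowOf_02, flowOf_10, flowOf_12, flowOf_20, flowOf_21,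
          FlowT]
        omega
      · simp only [flowOf_01, flowOf_02, flowOf_10, flowOf_12, flowOf_20, flowOf_21]
        push_cast
        intros
        refine ⟨?_, ?_, ?_, ?_⟩ <;> linarith
    · refine hasFrame_of (flowOf h 1 (h + 1) 1 1 1)
        (flowOf (h + 1) 0 (h + 1) 1 1 1) (flowOf (h + 1) 1 (h + 1) 0 2 0)
        (flowOf (h + 1) 1 (h + 2) 0 1 0) (flowOf h 1 (h + 2) 0 0 2) ?_ ?_
      · simp only [isFlow_flowOf, flowOf_01, flowOf_02, flowOf_10, flowOf_12, flowOf_20, flowOf_21,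
          FlowT]
        omega
      · simp only [flowOf_01, flowOf_02, flowOf_10, flowOf_12, flowOf_20, flowOf_21]
        push_cast
        intros
        refine ⟨?_, ?_, ?_, ?_⟩ <;> linarith
  | even hm =>
    obtain ⟨h, hh, hnh⟩ : ∃ h : ℤ, 0 ≤ h ∧ (n : ℤ) = 2 * h + 4 :=
      ⟨(n - 4) / 2, by omega, by omega⟩
    refine hasFrame_of (flowOf (h + 1) 0 (h + 1) 1 0 1)
      (flowOf h 1 (h + 1) 1 0 1) (flowOf (h + 1) 0 (h + 1) 1 1 0)
      (flowOf (h + 1) 1 (h + 2) 0 0 0) (flowOf (h + 1) 0 (h + 2) 0 0 1) ?_ ?_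
    · simp only [isFlow_flowOf, flowOf_01, flowOf_02, flowOf_10, flowOf_12, flowOf_20, flowOf_21,
        FlowT]
      omega
    · simp only [flowOf_01, flowOf_02, flowOf_10, flowOf_12, flowOf_20, flowOf_21]
      push_cast
      intros
      refine ⟨?_, ?_, ?_, ?_⟩ <;> linarith
  | odd hm =>
    obtain ⟨h, hh, hnh⟩ : ∃ h : ℤ, 0 ≤ h ∧ (n : ℤ) = 2 * h + 5 :=
      ⟨(n - 5) / 2, by omega, by omega⟩
    refine hasFrame_of (flowOf 0 (h + 1) 1 1 (h + 1) 1)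
      (flowOf 0 (h + 1) 0 2 (h + 1) 1) (flowOf 0 (h + 1) 0 1 (h + 2) 1)
      (flowOf 0 h 0 2 (h + 1) 2) (flowOf 1 h 0 2 (h + 2) 0) ?_ ?_
    · simp only [isFlow_flowOf, flowOf_01, flowOf_02, flowOf_10, flowOf_12, flowOf_20, flowOf_21,
        FlowT]
      omega
    · simp only [flowOf_01, flowOf_02, flowOf_10, flowOf_12, flowOf_20, flowOf_21]
      push_cast
      intros
      refine ⟨?_, ?_, ?_, ?_⟩ <;> linarith
  | three hm =>
    rcases (show n % 3 = 0 ∨ n % 3 = 1 by omega) with hm' | hm'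
    · obtain ⟨h, hh, hnh⟩ : ∃ h : ℤ, 0 ≤ h ∧ (n : ℤ) = 3 * h + 6 :=
        ⟨(n - 6) / 3, by omega, by omega⟩
      refine hasFrame_of (flowOf 0 (h + 2) (h + 1) 1 1 (h + 1))
        (flowOf 1 (h + 1) (h + 2) 1 0 (h + 1)) (flowOf 0 (h + 1) (h + 2) 1 0 (h + 2))
        (flowOf 0 (h + 2) (h + 1) 1 0 (h + 2)) (flowOf 1 (h + 2) (h + 2) 0 1 h) ?_ ?_
      · simp only [isFlow_flowOf, flowOf_01, flowOf_02, flowOf_10, flowOf_12, flowOf_20, flowOf_21,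
          FlowT]
        omega
      · simp only [flowOf_01, flowOf_02, flowOf_10, flowOf_12, flowOf_20, flowOf_21]
        push_cast
        intros
        refine ⟨?_, ?_, ?_, ?_⟩ <;> linarith
    · obtain ⟨h, hh, hnh⟩ : ∃ h : ℤ, 0 ≤ h ∧ (n : ℤ) = 3 * h + 4 :=
        ⟨(n - 4) / 3, by omega, by omega⟩
      refine hasFrame_of (flowOf 0 (h + 1) (h + 1) 1 0 (h + 1))
        (flowOf 1 (h + 1) (h + 2) 0 0 h) (flowOf 0 (h + 2) (h + 1) 0 0 (h + 1))
        (flowOf 0 (h + 2) (h + 1) 0 1 h) (flowOf 0 (h + 1) (h + 2) 0 0 (h + 1)) ?_ ?_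
      · simp only [isFlow_flowOf, flowOf_01, flowOf_02, flowOf_10, flowOf_12, flowOf_20, flowOf_21,
          FlowT]
        omega
      · simp only [flowOf_01, flowOf_02, flowOf_10, flowOf_12, flowOf_20, flowOf_21]
        push_cast
        intros
        refine ⟨?_, ?_, ?_, ?_⟩ <;> linarith
  | three' hm =>
    obtain ⟨h, hh, hnh⟩ : ∃ h : ℤ, 0 ≤ h ∧ (n : ℤ) = 3 * h + 5 :=
      ⟨(n - 5) / 3, by omega, by omega⟩
    refine hasFrame_of (flowOf 0 (h + 1) (h + 1) 1 1 (h + 1))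
      (flowOf 1 (h + 1) (h + 2) 0 1 h) (flowOf 1 h (h + 2) 1 0 (h + 1))
      (flowOf 0 (h + 1) (h + 2) 0 0 (h + 2)) (flowOf 0 (h + 2) (h + 2) 0 0 (h + 1)) ?_ ?_
    · simp only [isFlow_flowOf, flowOf_01, flowOf_02, flowOf_10, flowOf_12, flowOf_20, flowOf_21,
        FlowT]
      omega
    · simp only [flowOf_01, flowOf_02, flowOf_10, flowOf_12, flowOf_20, flowOf_21]
      push_cast
      intros
      refine ⟨?_, ?_, ?_, ?_⟩ <;> linarith

set_option linter.unusedSimpArgs false in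
/-- No form vanishes on all flows. -/
theorem IsForm.exists_pos {n : ℕ} (hn : 4 ≤ n) {F : (Fin 3 → Fin 3 → ℤ) → ℤ} (hF : IsForm n F) :
    ∃ z, IsFlow n z ∧ 0 < F z := by
  -- Words alternating between two states suffice. The second is needed because the even form
  -- vanishes on alternation between states 0 and 1.
  have h₁ : IsFlow n (flowOf (n - n / 2) 0 (n / 2) 0 0 0) := by
    simp only [isFlow_flowOf, FlowT]
    omega
  have h₂ : IsFlow n (flowOf 0 (n - n / 2) 0 0 (n / 2) 0) := by
    simp only [isFlow_flowOf, FlowT]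
    omega
  cases hF
  case even =>
    refine ⟨_, h₂, ?_⟩
    simp only [flowOf_10, flowOf_12]
    omega
  all_goals
    refine ⟨_, h₁, ?_⟩
    simp only [flowOf_01, flowOf_02, flowOf_10, flowOf_12, flowOf_20, flowOf_21]
    omega

/-! ### Validity, dimensions and completeness of the facet list -/

section Facets

variable {n : ℕ}

theorem nonneg_of_mem_tableVectors (hn : 0 < n) {b : Transition → ℝ}
    (hb : b ∈ tableVectors (n + 1)) {x : Transition → ℝ} (hx : x ∈ designPolytope (n + 1)) :
    0 ≤ b ⬝ᵥ x := by
  obtain ⟨F, hF, a, ha, hab⟩ := exists_form_of_mem_tableVectors hn hb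
  rw [designPolytope_eq] at hx
  refine nonneg_of_nonneg_on_generators _ (fun w => ?_) hx
  rw [hab _ (isFlow_countZ w)]
  exact mul_nonneg ha.le (by exact_mod_cast hF.nonneg (isFlow_countZ w))

theorem nonneg_of_mem_facetVectors (hn : 0 < n) {c : Transition → ℝ}
    (hc : c ∈ facetVectors (n + 1)) {x : Transition → ℝ} (hx : x ∈ designPolytope (n + 1)) :
    0 ≤ c ⬝ᵥ x := by
  obtain ⟨b, hb, e, he, rfl⟩ := exists_preserves_of_mem_facetVectors hn hc
  rw [comp_dotProduct]
  exact nonneg_of_mem_tableVectors hn hb (he.symm_mem.2 hx)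

theorem dim_of_mem_tableVectors (hn : 4 ≤ n) {b : Transition → ℝ}
    (hb : b ∈ tableVectors (n + 1)) :
    dim (tightSet (designPolytope (n + 1)) b) = 4 ∧ dim (designPolytope (n + 1)) = 5 := by
  have hn0 : 0 < n := by omega
  obtain ⟨F, hF, a, ha, hab⟩ := exists_form_of_mem_tableVectors hn0 hb
  obtain ⟨z₀, z₁, z₂, z₃, z₄, h₀, h₁, h₂, h₃, h₄, hli⟩ := hF.hasFrame hn
  obtain ⟨y, hy, hFy⟩ := hF.exists_pos hn
  have key : ∀ {z}, IsFlow n z ∧ F z = 0 → flowVec z ∈ tightSet (designPolytope (n + 1)) b :=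
    fun {z} h => ⟨flowVec_mem hn0 h.1, by rw [hab z h.1, h.2, Int.cast_zero, mul_zero]⟩
  refine dim_tightSet_of_independent (fun x hx => one_dotProduct_of_mem hx) (key h₀) (key h₁)
    (key h₂) (key h₃) (key h₄) hli (flowVec_mem hn0 hy) ?_
  rw [hab y hy]
  exact (mul_pos ha (by exact_mod_cast hFy)).ne'

theorem dim_designPolytope (hn : 4 ≤ n) : dim (designPolytope (n + 1)) = 5 :=
  (dim_of_mem_tableVectors hn (Or.inl rfl)).2

theorem dim_tightSet_of_mem_facetVectors (hn : 4 ≤ n) {c : Transition → ℝ}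
    (hc : c ∈ facetVectors (n + 1)) : dim (tightSet (designPolytope (n + 1)) c) = 4 := by
  obtain ⟨b, hb, e, he, rfl⟩ := exists_preserves_of_mem_facetVectors (by omega) hc
  rw [dim_tightSet_comp he]
  exact (dim_of_mem_tableVectors hn hb).1

theorem nonempty_of_dim {S : Set (Transition → ℝ)} (h : dim S = 4) : S.Nonempty := by
  by_contra hne
  rw [Set.not_nonempty_iff_eq_empty] at hne
  rw [hne, dim_empty] at h
  omega

theorem isFacet_tightSet (hn : 4 ≤ n) {c : Transition → ℝ} (hc : c ∈ facetVectors (n + 1)) :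
    IsFacet (designPolytope (n + 1)) (tightSet (designPolytope (n + 1)) c) := by
  have h := dim_tightSet_of_mem_facetVectors hn hc
  exact ⟨isFace_tightSet (fun _ => nonneg_of_mem_facetVectors (by omega) hc) (nonempty_of_dim h),
    by rw [h, dim_designPolytope hn]⟩

/-- The flows at which a linear functional with a proper nonempty face attains its minimum are
covered by a facet. -/
theorem covered_of_isLeast (hn : 4 ≤ n) {w : Transition → ℝ} {m : ℝ}
    (hlow : ∀ x ∈ designPolytope (n + 1), m ≤ w ⬝ᵥ x)
    (hne : ∃ x ∈ designPolytope (n + 1), m < w ⬝ᵥ x) :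
    Covered n fun z => IsFlow n z ∧ w ⬝ᵥ flowVec z = m := by
  have hn0 : 0 < n := by omega
  have hdot (a b c d e f : ℤ) := dotProduct_transition w (flowVec (flowOf a b c d e f))
  have hdot' (z : Fin 3 → Fin 3 → ℤ) := dotProduct_transition w (flowVec z)
  refine Setup.covered (m := m) (i := 0) (j := 1) (k := 2) (wij := w ⟨(0, 1), by decide⟩)
    (wik := w ⟨(0, 2), by decide⟩) (wji := w ⟨(1, 0), by decide⟩)
    (wjk := w ⟨(1, 2), by decide⟩) (wki := w ⟨(2, 0), by decide⟩)
    (wkj := w ⟨(2, 1), by decide⟩) (by exact_mod_cast hn) ?_ ?_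
  · refine ⟨by decide, by decide, by decide, fun a b c d e f h => ?_, fun z hz => ⟨hz.1, ?_⟩⟩
    · exact (hlow _ (flowVec_mem hn0 (isFlow_flowOf.2 h))).trans_eq (hdot a b c d e f)
    · exact (hdot' z).symm.trans hz.2
  · by_contra! hcon
    obtain ⟨x, hx, hmx⟩ := hne
    rw [designPolytope_eq] at hx
    have := nonneg_of_nonneg_on_generators (c := -w) (m := -m) _ (fun v : Word (n + 1) => by
      rw [neg_dotProduct, neg_le_neg_iff]
      exact (hdot' _).trans_le (hcon _ _ _ _ _ _ (isFlow_countZ v))) hx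
    rw [neg_dotProduct] at this
    linarith

/-- The functional of a facet is nonconstant on the polytope, since otherwise the facet would have
dimension 5. The flows in the facet are thus covered by a facet vector; its tight set contains the
facet and has the same dimension 4. -/
theorem exists_tightSet_of_isFacet (hn : 4 ≤ n) {F : Set (Transition → ℝ)}
    (hF : IsFacet (designPolytope (n + 1)) F) :
    ∃ c ∈ facetVectors (n + 1), tightSet (designPolytope (n + 1)) c = F := by
  have hn0 : 0 < n := by omega
  have hP := dim_designPolytope hn
  have hdim : dim F = 4 := by have := hF.2; omega
  have hne := nonempty_of_dim hdim
  have hF' := hF.1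
  obtain ⟨u, hu⟩ := hF.1
  obtain ⟨x₀, h₀⟩ := hne
  have h₀' := h₀
  rw [hu] at h₀'
  -- Faces are sets of maximisers, while the covering argument minimises; hence the weight -u.
  have hlow : ∀ x ∈ designPolytope (n + 1), -u ⬝ᵥ x₀ ≤ -u ⬝ᵥ x := fun x hx => by
    rw [neg_dotProduct, neg_dotProduct, neg_le_neg_iff]
    exact h₀'.2 x hx
  have hcov := covered_of_isLeast hn hlow <| by
    by_contra! hcon
    have : F = designPolytope (n + 1) := by
      rw [hu]
      refine Set.Subset.antisymm (fun x hx => hx.1) fun x hx => ⟨hx, fun y hy => ?_⟩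
      have := hcon x hx
      rw [neg_dotProduct, neg_dotProduct, neg_le_neg_iff] at this
      exact (h₀'.2 y hy).trans this
    rw [this] at hdim
    omega
  obtain ⟨c, hc, hzero⟩ := exists_mem_facetVectors_of_covered hn0 (fun z hz => hz.1) hcov
  refine ⟨c, hc, (eq_tightSet_of_subset hF' (fun x hx => ?_) ⟨x₀, h₀⟩
    (hdim.trans (dim_tightSet_of_mem_facetVectors hn hc).symm)).symm⟩
  rw [hu] at hx
  refine ⟨hx.1, le_antisymm ?_ (nonneg_of_mem_facetVectors hn0 hc hx.1)⟩
  refine tight_of_tight_on_generators (fun w : Word (n + 1) => flowVec (countZ w.1))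
    (w := -u) (m := -u ⬝ᵥ x₀)
    (fun w => nonneg_of_mem_facetVectors hn0 hc (flowVec_mem hn0 (isFlow_countZ w)))
    (fun w => hlow _ (flowVec_mem hn0 (isFlow_countZ w)))
    (fun w hw => hzero _ ⟨isFlow_countZ w, hw⟩) (designPolytope_eq n ▸ hx.1) ?_
  rw [neg_dotProduct, neg_dotProduct, neg_le_neg_iff]
  exact hx.2 x₀ h₀'.1

theorem exists_smul_of_tightSet_eq_of_mem (hn : 4 ≤ n) {c c' : Transition → ℝ}
    (hc : c ∈ facetVectors (n + 1)) (hc' : c' ∈ facetVectors (n + 1))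
    (h : tightSet (designPolytope (n + 1)) c = tightSet (designPolytope (n + 1)) c') :
    ∃ a : ℝ, 0 < a ∧ c' = a • c :=
  exists_smul_of_tightSet_eq (N := n) (by norm_cast; omega) (fun _ => one_dotProduct_of_mem)
    (fun _ => nonneg_of_mem_facetVectors (by omega) hc)
    (fun _ => nonneg_of_mem_facetVectors (by omega) hc') h
    (dim_tightSet_of_mem_facetVectors hn hc) (dim_designPolytope hn)

end Facets

/-! ### Sign and order patterns of the table rows -/

section Levels

/-- The array of levels with the given off-diagonal entries. -/
def levelArray (a b c d e f : Fin 5) : Fin 3 → Fin 3 → Fin 5 := ![![0, a, b], ![c, 0, d], ![e, f, 0]]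

theorem vec_levels (L : Fin 5 → ℝ) (a b c d e f : Fin 5) :
    vec (L a) (L b) (L c) (L d) (L e) (L f) =
      fun p => L (levelArray a b c d e f p.1.1 p.1.2) := by
  funext ⟨⟨i, j⟩, h⟩
  fin_cases i <;> fin_cases j <;> first | rfl | exact absurd rfl h

/-- An increasing sequence of five real numbers with middle term zero. -/
def IsScale (L : Fin 5 → ℝ) : Prop := StrictMono L ∧ L 2 = 0

theorem isScale {a b d e : ℝ} (hab : a < b) (hb : b < 0) (hd : 0 < d) (hde : d < e) :
    IsScale ![a, b, 0, d, e] := by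
  refine ⟨Fin.strictMono_iff_lt_succ.2 fun i => ?_, rfl⟩
  fin_cases i
  exacts [hab, hb, hd, hde]

/-- The relative sizes of the entries of the rows of the table, where level `2` stands for zero.
The last two rows depend on the length of the words modulo `2` and `3`. -/
def tableLevels (s t : Bool) : Fin 4 → Fin 3 → Fin 3 → Fin 5 :=
  ![levelArray 3 2 2 2 2 2, levelArray 4 4 1 3 1 3,
    cond s (levelArray 3 3 1 1 3 3) (levelArray 4 3 1 1 1 3),
    cond t (levelArray 4 1 1 1 4 4) (levelArray 4 3 0 1 1 3)]

/-- Only the pattern of the row matters later, so levels that do not occur in it receive arbitrary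
values compatible with `IsScale`. -/
theorem exists_levels_parity {T : ℕ} (hT : 5 ≤ T) : ∃ (s : Bool) (L : Fin 5 → ℝ), IsScale L ∧
    ∀ c, ((Odd T ∧ c = vec 1 1 (-1) (-1) 1 1) ∨
      (Even T ∧ c = vec (3 / 2 * (T : ℝ) - 1) ((T : ℝ) / 2) (-(T : ℝ) / 2 + 1)
        (-(T : ℝ) / 2 + 1) (-(T : ℝ) / 2 + 1) ((T : ℝ) / 2))) ↔
      c = fun p => L (cond s (levelArray 3 3 1 1 3 3) (levelArray 4 3 1 1 1 3) p.1.1 p.1.2) := by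
  have hT' : (5 : ℝ) ≤ T := by exact_mod_cast hT
  rcases Nat.even_or_odd T with h | h
  · refine ⟨false, ![-(T : ℝ) / 2, -(T : ℝ) / 2 + 1, 0, (T : ℝ) / 2, 3 / 2 * (T : ℝ) - 1],
      isScale (by linarith) (by linarith) (by linarith) (by linarith), fun c => ?_⟩
    rw [cond_false, ← vec_levels]
    simp only [h, true_and, Nat.not_odd_iff_even.2 h, false_and, false_or]
    exact Iff.rfl
  · refine ⟨true, ![-2, -1, 0, 1, 2],
      isScale (by norm_num) (by norm_num) (by norm_num) (by norm_num), fun c => ?_⟩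
    rw [cond_true, ← vec_levels]
    simp only [h, true_and, Nat.not_even_iff_odd.2 h, false_and, or_false]
    exact Iff.rfl

theorem exists_levels_mod_three {T : ℕ} (hT : 5 ≤ T) : ∃ (t : Bool) (L : Fin 5 → ℝ), IsScale L ∧
    ∀ c, ((∃ k : ℕ, T = 3 * k + 1 ∧ c = vec 2 (-1) (-1) (-1) 2 2) ∨
      (∃ k : ℕ, T = 3 * k + 2 ∧
        c = vec (2 * (k : ℝ) + 1) (-(k : ℝ)) (-(k : ℝ)) (-(k : ℝ)) (2 * (k : ℝ) + 1)
          (2 * (k : ℝ) + 1)) ∨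
      (∃ k : ℕ, T = 6 * k + 3 ∧
        c = vec (5 * (k : ℝ) + 2) (2 * (k : ℝ) + 1) (-4 * (k : ℝ) - 1) (-(k : ℝ)) (-(k : ℝ))
          (2 * (k : ℝ) + 1)) ∨
      (∃ k : ℕ, T = 6 * k ∧
        c = vec (10 * (k : ℝ) - 1) (4 * (k : ℝ)) (-8 * (k : ℝ) + 2) (-2 * (k : ℝ) + 1)
          (-2 * (k : ℝ) + 1) (4 * (k : ℝ)))) ↔
      c = fun p => L (cond t (levelArray 4 1 1 1 4 4) (levelArray 4 3 0 1 1 3) p.1.1 p.1.2) := by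
  rcases (show T % 3 = 1 ∨ T % 3 = 2 ∨ T % 6 = 3 ∨ T % 6 = 0 by omega) with h | h | h | h
  · refine ⟨true, ![-2, -1, 0, 1, 2],
      isScale (by norm_num) (by norm_num) (by norm_num) (by norm_num), fun c => ?_⟩
    rw [cond_true, ← vec_levels]
    constructor
    · rintro (⟨k, hk, rfl⟩ | ⟨k, hk, rfl⟩ | ⟨k, hk, rfl⟩ | ⟨k, hk, rfl⟩)
      · rfl
      all_goals omega
    · rintro rfl
      exact Or.inl ⟨T / 3, by omega, rfl⟩
  · obtain ⟨k, rfl⟩ : ∃ k, T = 3 * k + 2 := ⟨T / 3, by omega⟩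
    -- T ≥ 5 excludes k = 0, for which the entry -k would vanish and the pattern degenerate.
    have hk : (1 : ℝ) ≤ k := by norm_cast; omega
    refine ⟨true, ![-(k : ℝ) - 1, -(k : ℝ), 0, 1, 2 * (k : ℝ) + 1],
      isScale (by linarith) (by linarith) (by linarith) (by linarith), fun c => ?_⟩
    rw [cond_true, ← vec_levels]
    constructor
    · rintro (⟨l, hl, rfl⟩ | ⟨l, hl, rfl⟩ | ⟨l, hl, rfl⟩ | ⟨l, hl, rfl⟩)
      on_goal 2 =>
        obtain rfl : k = l := by omega
        rfl
      all_goals omega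
    · rintro rfl
      exact Or.inr (Or.inl ⟨k, rfl, rfl⟩)
  · obtain ⟨k, rfl⟩ : ∃ k, T = 6 * k + 3 := ⟨T / 6, by omega⟩
    have hk : (1 : ℝ) ≤ k := by norm_cast; omega
    refine ⟨false, ![-4 * (k : ℝ) - 1, -(k : ℝ), 0, 2 * (k : ℝ) + 1, 5 * (k : ℝ) + 2],
      isScale (by linarith) (by linarith) (by linarith) (by linarith), fun c => ?_⟩
    rw [cond_false, ← vec_levels]
    constructor
    · rintro (⟨l, hl, rfl⟩ | ⟨l, hl, rfl⟩ | ⟨l, hl, rfl⟩ | ⟨l, hl, rfl⟩)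
      on_goal 3 =>
        obtain rfl : k = l := by omega
        rfl
      all_goals omega
    · rintro rfl
      exact Or.inr (Or.inr (Or.inl ⟨k, rfl, rfl⟩))
  · obtain ⟨k, rfl⟩ : ∃ k, T = 6 * k := ⟨T / 6, by omega⟩
    have hk : (1 : ℝ) ≤ k := by norm_cast; omega
    refine ⟨false, ![-8 * (k : ℝ) + 2, -2 * (k : ℝ) + 1, 0, 4 * (k : ℝ), 10 * (k : ℝ) - 1],
      isScale (by linarith) (by linarith) (by linarith) (by linarith), fun c => ?_⟩
    rw [cond_false, ← vec_levels]
    constructor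
    · rintro (⟨l, hl, rfl⟩ | ⟨l, hl, rfl⟩ | ⟨l, hl, rfl⟩ | ⟨l, hl, rfl⟩)
      on_goal 4 =>
        obtain rfl : k = l := by omega
        rfl
      all_goals omega
    · rintro rfl
      exact Or.inr (Or.inr (Or.inr ⟨k, rfl, rfl⟩))

theorem exists_levels {T : ℕ} (hT : 5 ≤ T) : ∃ (s t : Bool) (L : Fin 4 → Fin 5 → ℝ),
    (∀ r, IsScale (L r)) ∧
    tableVectors T = Set.range fun r (p : Transition) => L r (tableLevels s t r p.1.1 p.1.2) := by
  have hT' : (5 : ℝ) ≤ T := by exact_mod_cast hT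
  obtain ⟨s, L₂, h₂, H₂⟩ := exists_levels_parity hT
  obtain ⟨t, L₃, h₃, H₃⟩ := exists_levels_mod_three hT
  have h₀ : IsScale ![-2, -1, 0, 1, 2] :=
    isScale (by norm_num) (by norm_num) (by norm_num) (by norm_num)
  have h₁ : IsScale ![-((T : ℝ) - 1), -((T : ℝ) - 2), 0, 1, T] :=
    isScale (by linarith) (by linarith) (by linarith) (by linarith)
  refine ⟨s, t, ![_, _, L₂, L₃], fun r => by fin_cases r; exacts [h₀, h₁, h₂, h₃], ?_⟩
  ext c
  have e₀ := vec_levels ![-2, -1, 0, 1, 2] 3 2 2 2 2 2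
  have e₁ := vec_levels ![-((T : ℝ) - 1), -((T : ℝ) - 2), 0, 1, T] 4 4 1 3 1 3
  simp only [Set.mem_range, Fin.exists_fin_succ, Fin.exists_fin_zero, or_false]
  refine Iff.trans ?_ (or_congr ⟨fun h => (e₀.symm.trans h.symm), fun h => (e₀.trans h).symm⟩
    (or_congr ⟨fun h => (e₁.symm.trans h.symm), fun h => (e₁.trans h).symm⟩
    (or_congr ((H₂ c).trans eq_comm) ((H₃ c).trans eq_comm))))
  rw [tableVectors, Set.mem_ofPred_eq, or_assoc (a := _ ∧ _)]
  exact Iff.rfl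

end Levels

/-! ### Counting the orbits of the table rows -/

section Orbits

/-- A row of the table together with a relabelling of the states and a choice of direction. -/
abbrev OrbitIndex : Type := Fin 4 × Equiv.Perm (Fin 3) × Bool

/-- The permutation of the transitions that belongs to an index. -/
def OrbitIndex.act (x : OrbitIndex) (p : Transition) : Transition :=
  relabelEquiv x.2.1 (cond x.2.2 (reverseEquiv p) p)

/-- The relative sizes of the entries of the vector that belongs to an index. -/
def OrbitIndex.levels (s t : Bool) (x : OrbitIndex) (p : Transition) : Fin 5 :=
  tableLevels s t x.1 (x.act p).1.1 (x.act p).1.2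

-- Which entries are negative and how the entries are ordered is invariant under positive scaling.
-- These data already determine the row and the full pattern, which is a finite check over 48
-- indices for each of the four choices of s and t.
set_option synthInstance.maxSize 2000 in
theorem OrbitIndex.levels_inj (s t : Bool) : ∀ x y : OrbitIndex,
    (∀ p, (x.levels s t p < 2 ↔ y.levels s t p < 2)) →
    (∀ p q, x.levels s t p < x.levels s t q ↔ y.levels s t p < y.levels s t q) →
    x.1 = y.1 ∧ x.levels s t = y.levels s t := by
  revert s t
  decide +kernel

theorem OrbitIndex.card_image_levels (s t : Bool) :
    (Finset.univ.image (OrbitIndex.levels s t)).card = 24 := by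
  revert s t
  decide +kernel

theorem IsScale.neg_iff {L : Fin 5 → ℝ} (hL : IsScale L) (i : Fin 5) : L i < 0 ↔ i < 2 := by
  rw [← hL.2, hL.1.lt_iff_lt]

theorem facetVectors_eq_range {T : ℕ} {s t : Bool} {L : Fin 4 → Fin 5 → ℝ}
    (h : tableVectors T =
      Set.range fun r (p : Transition) => L r (tableLevels s t r p.1.1 p.1.2)) :
    facetVectors T = Set.range fun (x : OrbitIndex) p => L x.1 (x.levels s t p) := by
  ext c
  rw [facetVectors, Set.mem_ofPred_eq, h]
  constructor
  · rintro ⟨_, ⟨r, rfl⟩, σ, rfl | rfl⟩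
    · exact ⟨(r, σ, false), rfl⟩
    · exact ⟨(r, σ, true), rfl⟩
  · rintro ⟨⟨r, σ, _ | _⟩, rfl⟩
    · exact ⟨_, ⟨r, rfl⟩, σ, Or.inl rfl⟩
    · exact ⟨_, ⟨r, rfl⟩, σ, Or.inr rfl⟩

theorem levels_eq_of_smul {s t : Bool} {L : Fin 4 → Fin 5 → ℝ} (hL : ∀ r, IsScale (L r))
    {x y : OrbitIndex} {a : ℝ} (ha : 0 < a)
    (h : (fun p => L y.1 (y.levels s t p)) = a • fun p => L x.1 (x.levels s t p)) :
    x.1 = y.1 ∧ x.levels s t = y.levels s t := by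
  have h' (p : Transition) : L y.1 (y.levels s t p) = a * L x.1 (x.levels s t p) := congrFun h p
  refine OrbitIndex.levels_inj s t x y (fun p => ?_) fun p q => ?_
  · rw [← (hL x.1).neg_iff, ← (hL y.1).neg_iff, h', ← mul_lt_mul_iff_right₀ ha (b := L x.1 _), mul_zero]
  · rw [← (hL x.1).1.lt_iff_lt, ← (hL y.1).1.lt_iff_lt, h', h', mul_lt_mul_iff_right₀ ha]

/-- No two of the facet vectors are positive multiples of each other. -/
theorem eq_of_mem_facetVectors_of_smul {T : ℕ} (hT : 5 ≤ T) {c : Transition → ℝ}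
    (hc : c ∈ facetVectors T) {a : ℝ} (ha : 0 < a) (hac : a • c ∈ facetVectors T) : a • c = c := by
  obtain ⟨s, t, L, hL, htab⟩ := exists_levels hT
  rw [facetVectors_eq_range htab] at hc hac
  obtain ⟨x, rfl⟩ := hc
  obtain ⟨y, hy⟩ := hac
  obtain ⟨h₁, h₂⟩ := levels_eq_of_smul hL ha hy
  rw [← hy]
  funext p
  simp only [h₁, h₂]

theorem ncard_range_congr {α β γ : Type*} {f : α → β} {g : α → γ}
    (h : ∀ x y, f x = f y ↔ g x = g y) : (Set.range f).ncard = (Set.range g).ncard := by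
  have hker : Setoid.ker f = Setoid.ker g := Setoid.ext fun x y => h x y
  rw [← Nat.card_coe_set_eq, ← Nat.card_coe_set_eq,
    ← Nat.card_congr (Setoid.quotientKerEquivRange f),
    ← Nat.card_congr (Setoid.quotientKerEquivRange g), hker]

theorem ncard_facetVectors {T : ℕ} (hT : 5 ≤ T) : (facetVectors T).ncard = 24 := by
  obtain ⟨s, t, L, hL, htab⟩ := exists_levels hT
  have hker : ∀ x y : OrbitIndex, ((fun p => L x.1 (x.levels s t p)) = fun p =>
      L y.1 (y.levels s t p)) ↔ x.levels s t = y.levels s t := fun x y => by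
    refine ⟨fun h => (levels_eq_of_smul hL one_pos (by rw [one_smul, h])).2, fun h => ?_⟩
    obtain ⟨h', -⟩ := OrbitIndex.levels_inj s t x y (fun p => by rw [h]) fun p q => by rw [h]
    rw [h, h']
  rw [facetVectors_eq_range htab, ncard_range_congr hker, ← OrbitIndex.card_image_levels s t,
    ← Set.ncard_coe_finset, Finset.coe_image, Finset.coe_univ, Set.image_univ]

end Orbits

end THMC

theorem mainTheorem1 (T : ℕ) (hT : 5 ≤ T) :
    (∀ c ∈ THMC.facetVectors T, ∀ x ∈ THMC.designPolytope T, 0 ≤ c ⬝ᵥ x) ∧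
    Set.BijOn (THMC.tightSet (THMC.designPolytope T)) (THMC.facetVectors T)
      {F | THMC.IsFacet (THMC.designPolytope T) F} ∧
    {F | THMC.IsFacet (THMC.designPolytope T) F}.ncard = 24 := by
  have hbij : Set.BijOn (THMC.tightSet (THMC.designPolytope T)) (THMC.facetVectors T)
      {F | THMC.IsFacet (THMC.designPolytope T) F} := by
    obtain ⟨n, rfl⟩ : ∃ n, T = n + 1 := ⟨T - 1, by omega⟩
    have hn : 4 ≤ n := by omega
    refine ⟨fun c hc => THMC.isFacet_tightSet hn hc, fun c hc c' hc' h => ?_,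
      fun F hF => THMC.exists_tightSet_of_isFacet hn hF⟩
    obtain ⟨a, ha, rfl⟩ := THMC.exists_smul_of_tightSet_eq_of_mem hn hc hc' h
    exact (THMC.eq_of_mem_facetVectors_of_smul hT hc ha hc').symm
  refine ⟨fun c hc x hx => ?_, hbij, ?_⟩
  · obtain ⟨n, rfl⟩ : ∃ n, T = n + 1 := ⟨T - 1, by omega⟩
    exact THMC.nonneg_of_mem_facetVectors (by omega) hc hx
  · rw [← hbij.image_eq, hbij.injOn.ncard_image, THMC.ncard_facetVectors hT]
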